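/- Let $n\ge 17^3$, let $G_1,\dots,G_n:\mathbb R^d\to\mathbb R^d$, and put $Gx=\frac1n\sum_{i=1}^nG_ix$. Assume that for some $L>0$ $$\frac1n\sum_{i=1}^n\langle G_ix-G_iy,x-y\rangle\ \ge\ \frac1L\cdot\frac1n\sum_{i=1}^n\|G_ix-G_iy\|^2\qquad(x,y\in\mathbb R^d),$$ and that $G$ is $\sigma$-strongly quasi-monotone: for some $x^\star$ with $Gx^\star=0$ and some $\sigma>0$, $\langle Gx,x-x^\star\rangle\ge\sigma\|x-x^\star\|^2$ for all $x$. Put $\kappa=L/\sigma$. For $\rho\in(0,\frac12)$ and $\Theta,\hat\Theta\ge 0$ with $\Theta+\hat\Theta>0$, let $\Gamma=\rho+2(\Theta+\hat\Theta)$, $M=2(2\Gamma-1)\kappa$, $N=3\Gamma\kappa+2(1-2\rho)$ and $$\bar\beta(\rho,\Theta,\hat\Theta)=\frac1\sigma\min\Big\{\frac35,\ \frac{3\rho}{2(1-2\rho)},\ \frac1{2\kappa},\ \frac{6\rho}{N+\sqrt{N^2+12\rho M}}\Big\}.$$ Given $x^0\in\mathbb R^d$ and $x^{-1}=x^0$,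 consider $$x^{k+1}=x^k+\theta(x^k-x^{k-1})-\eta\,\widetilde S^k,\qquad \theta=\tfrac13,\quad \gamma=\tfrac12,\quad \eta=\bar\beta,\qquad k\ge0,$$ where $\widetilde S^k$ is one of the following estimators of $Gx^k-\gamma Gx^{k-1}$. In both, $\mathcal B_0,\mathcal B_1,\dots$ are independent and uniformly distributed on the subsets of $\{1,\dots,n\}$ of size $b$, and $G_{\mathcal B}x=\frac1b\sum_{i\in\mathcal B}G_ix$. (SVRG) $\widetilde S^k=(1-\gamma)(Gw^k-G_{\mathcal B_k}w^k)+G_{\mathcal B_k}x^k-\gamma G_{\mathcal B_k}x^{k-1}$, where the snapshot is initialized at $x^0$ and, independently of everything else, $w^k=x^{k-1}$ with probability $\mathbf p$ and $w^k=w^{k-1}$ otherwise. Here $1\le b\le n$, $\mathbf p\in(0,1)$, and $\bar\beta$ is taken at $\rho=\frac{\mathbf p}2$, $\Theta=\frac{4-6\mathbf p+3\mathbf p^2}{b\mathbf p}$, $\hat\Theta=\frac{2(2-3\mathbf p+\mathbf p^2)}{b\mathbf p}$. (SAGA) $\widetilde S^k=\frac{1-\gamma}n\sum_{i=1}^n\widehat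 G^k_i+\frac1b\sum_{i\in\mathcal B_k}\big[G_ix^k-\gamma G_ix^{k-1}-(1-\gamma)\widehat G^k_i\big]$, where $\widehat G^0_i=G_ix^0$ and, after iteration $k$, $\widehat G^{k+1}_i=G_ix^k$ for $i\in\mathcal B_k$ and $\widehat G^{k+1}_i=\widehat G^k_i$ for $i\notin\mathcal B_k$. Here $1\le b<n$ and $\bar\beta$ is taken at $\rho=\frac b{2n}$, $\Theta=\frac{2(n-b)(2n+b)+b^2}{nb^2}$, $\hat\Theta=\frac{2(n-b)(2n+b)}{nb^2}$. The oracle cost is the number of evaluations $(i,x)\mapsto G_ix$: $n$ at the start, and then per iteration $3b$ for SVRG (plus $n$ whenever the snapshot is replaced) and $2b$ for SAGA. Then for all constants $0<c_1\le c_2$ there is a constant $C$, which depends only on $c_1$ and $c_2$ (not on $n$, $d$, the $G_i$, $L$, $\sigma$, $x^0$, $\varepsilon$), such that the following holds for every $\varepsilon\in(0,\frac12]$. (a) If $c_1n^{2/3}\le b\le c_2n^{2/3}$ and $c_1n^{-1/3}\le\mathbf p\le c_2n^{-1/3}$, the SVRG variant reaches an iteration $K$ with $\mathbb E\|x^k-x^\star\|^2\le\varepsilon^2$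 for all $k\ge K$, and the expected number of evaluations of the $G_i$ made to compute $x^K$ is at most $$C\Big(n+\max\{n,n^{2/3}\kappa\}\big[\log\tfrac1\varepsilon+\log\max\{1,\|x^0-x^\star\|\}\big]\Big).$$ (b) If $c_1n^{2/3}\le b\le c_2n^{2/3}$, the same holds for the SAGA variant. -/

import Mathlib

open MeasureTheory ProbabilityTheory

/-! ### Algorithms that access `G_1, …, G_n` only through counted evaluations -/

/-- A computation returning an element of `α` whose only access to the operators
`G_i : E → E` is through evaluation queries `(i, x) ↦ G_i x`. -/
inductive OracleComp (n : ℕ) (E α : Type) : Type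
  | done (a : α) : OracleComp n E α
  | query (i : Fin n) (x : E) (cont : E → OracleComp n E α) : OracleComp n E α

namespace OracleComp

variable {n : ℕ} {E α β : Type}

/-- Sequential composition. -/
def bind : OracleComp n E α → (α → OracleComp n E β) → OracleComp n E β
  | done a, f => f a
  | query i x cont, f => query i x (fun y => bind (cont y) f)

instance : Monad (OracleComp n E) where
  pure := done
  bind := bind

/-- The value returned when the queries are answered by `G`. -/
def eval (G : Fin n → E → E) : OracleComp n E α → α
  | done a => a
  | query i x cont => eval G (cont (G i x))

/-- The number of evaluations of the `G_i` that are made when the queries are answered by `G`. -/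
def calls (G : Fin n → E → E) : OracleComp n E α → ℕ
  | done _ => 0
  | query i x cont => calls G (cont (G i x)) + 1

/-- Evaluate `G_i x` for every `i` in a list and collect the values in a vector
(with entry `0` at the indices that are not in the list). -/
def askList [Zero E] (x : E) : List (Fin n) → OracleComp n E (Fin n → E)
  | [] => done 0
  | i :: l => query i x (fun y => bind (askList x l) (fun g => done (Function.update g i y)))

/-- Evaluate `G_i x` for all `i ∈ B`; this costs `|B|` evaluations. -/
noncomputable def ask [Zero E] (B : Finset (Fin n)) (x : E) : OracleComp n E (Fin n → E) :=
  askList x B.toList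

end OracleComp

/-! ### The equation `G x = 0`, `G = (1/n) ∑ G_i` -/

section Problem

variable {n : ℕ} {E : Type} [NormedAddCommGroup E] [InnerProductSpace ℝ E]

/-- The average of `g i` over `i ∈ B`. -/
noncomputable def batchMean (B : Finset (Fin n)) (g : Fin n → E) : E :=
  (B.card : ℝ)⁻¹ • ∑ i ∈ B, g i

/-- `G x = (1/n) ∑_{i=1}^n G_i x`. -/
noncomputable def meanOp (G : Fin n → E → E) (x : E) : E :=
  batchMean Finset.univ (fun i => G i x)

/-- `(1/n) ∑ ⟪G_i x - G_i y, x - y⟫ ≥ (1/L) · (1/n) ∑ ‖G_i x - G_i y‖²` for all `x`, `y`. -/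
def AverageCocoercive (G : Fin n → E → E) (L : ℝ) : Prop :=
  ∀ x y : E,
    (1 / L) * ((1 / (n : ℝ)) * ∑ i, ‖G i x - G i y‖ ^ 2) ≤
      (1 / (n : ℝ)) * ∑ i, inner ℝ (G i x - G i y) (x - y)

/-- `xs` is a zero of `F`, and `⟪F x, x - xs⟫ ≥ σ ‖x - xs‖²` for all `x`. -/
def StronglyQuasiMonotoneAt (F : E → E) (σ : ℝ) (xs : E) : Prop :=
  F xs = 0 ∧ ∀ x : E, σ * ‖x - xs‖ ^ 2 ≤ inner ℝ (F x) (x - xs)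

end Problem

/-! ### The method with the loopless SVRG estimator and with the SAGA estimator

The parameters are constant: inertia `θ`, correction `γ`, step size `η`. -/

section Method

variable {n : ℕ} {E : Type} [NormedAddCommGroup E] [InnerProductSpace ℝ E]

/-- `x^{k+1} = x^k + θ (x^k - x^{k-1}) - η S`, where `S` is the estimator of
`G x^k - γ G x^{k-1}`. -/
def kmUpdate (θ η : ℝ) (x xprev S : E) : E :=
  x + θ • (x - xprev) - η • S

/-- The data kept by the SVRG variant at the beginning of iteration `k`: the points `x^k` and
`x^{k-1}`, the current snapshot point `w` and the stored value `G w`. -/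
structure SVRGState (E : Type) where
  cur : E
  prev : E
  snap : E
  snapVal : E

/-- `x^{-1} = w = x^0`; the value `G w` costs `n` evaluations. -/
noncomputable def svrgInit (x₀ : E) : OracleComp n E (SVRGState E) := do
  let g ← OracleComp.ask Finset.univ x₀
  pure ⟨x₀, x₀, x₀, batchMean Finset.univ g⟩

/-- Iteration `k` with mini-batch `B = B_k`; `refresh` says whether `w^k = x^{k-1}` (with `n`
evaluations for the new value `G w^k`) or `w^k = w^{k-1}`. The estimator is
`(1 - γ) (G w^k - G_B w^k) + G_B x^k - γ G_B x^{k-1}`.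
For `k = 0` all the points coincide and the estimator is exactly `G x^0 - γ G x^{-1}`. -/
noncomputable def svrgStep (θ γ η : ℝ) (B : Finset (Fin n)) (refresh : Bool)
    (s : SVRGState E) : OracleComp n E (SVRGState E) := do
  let (w, Gw) ←
    if refresh then do
      let g ← OracleComp.ask Finset.univ s.prev
      pure (s.prev, batchMean Finset.univ g)
    else
      pure (s.snap, s.snapVal)
  let gw ← OracleComp.ask B w
  let gx ← OracleComp.ask B s.cur
  let gp ← OracleComp.ask B s.prev
  let S : E := (1 - γ) • (Gw - batchMean B gw) + batchMean B gx - γ • batchMean B gp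
  pure ⟨kmUpdate θ η s.cur s.prev S, s.cur, w, Gw⟩

/-- The first `k` iterations of the SVRG variant, for given mini-batches and coin flips. -/
noncomputable def svrgRun (θ γ η : ℝ) (B : ℕ → Finset (Fin n)) (refresh : ℕ → Bool) (x₀ : E) :
    ℕ → OracleComp n E (SVRGState E)
  | 0 => svrgInit x₀
  | k + 1 => do
      let s ← svrgRun θ γ η B refresh x₀ k
      svrgStep θ γ η (B k) (refresh k) s

/-- The data kept by the SAGA variant at the beginning of iteration `k`: the points `x^k` and
`x^{k-1}` and the table `(Ĝ^k_i)_i`. -/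
structure SAGAState (n : ℕ) (E : Type) where
  cur : E
  prev : E
  table : Fin n → E

/-- `x^{-1} = x^0` and `Ĝ^0_i = G_i x^0`, at the cost of `n` evaluations. -/
noncomputable def sagaInit (x₀ : E) : OracleComp n E (SAGAState n E) := do
  let g ← OracleComp.ask Finset.univ x₀
  pure ⟨x₀, x₀, g⟩

/-- Iteration `k` with mini-batch `B = B_k`. The estimator is
`(1 - γ)/n ∑ Ĝ^k_i + G_B x^k - γ G_B x^{k-1} - (1 - γ) Ĝ^k_B`; it uses the table as it is before
this mini-batch is drawn. After that, the entries `i ∈ B` of the table become `G_i x^k`.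
For `k = 0` the estimator is exactly `G x^0 - γ G x^{-1}`. -/
noncomputable def sagaStep (θ γ η : ℝ) (B : Finset (Fin n)) (s : SAGAState n E) :
    OracleComp n E (SAGAState n E) := do
  let gx ← OracleComp.ask B s.cur
  let gp ← OracleComp.ask B s.prev
  let S : E := (1 - γ) • batchMean Finset.univ s.table +
    (batchMean B gx - γ • batchMean B gp - (1 - γ) • batchMean B s.table)
  pure ⟨kmUpdate θ η s.cur s.prev S, s.cur, fun i => if i ∈ B then gx i else s.table i⟩

/-- The first `k` iterations of the SAGA variant, for given mini-batches. -/
noncomputable def sagaRun (θ γ η : ℝ) (B : ℕ → Finset (Fin n)) (x₀ : E) :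
    ℕ → OracleComp n E (SAGAState n E)
  | 0 => sagaInit x₀
  | k + 1 => do
      let s ← sagaRun θ γ η B x₀ k
      sagaStep θ γ η (B k) s

end Method

/-! ### The randomness of the algorithms -/

/-- `B_0, B_1, …` are independent and uniformly distributed on the subsets of size `b` of
`{1, …, n}`. -/
structure IsMinibatchSampling {Ω : Type*} [MeasurableSpace Ω] (μ : Measure Ω) {n : ℕ} (b : ℕ)
    (B : ℕ → Ω → Finset (Fin n)) : Prop where
  measurable : ∀ k, Measurable (B k)
  indep : iIndepFun B μ
  law : ∀ k (S : Finset (Fin n)), S.card = b →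
    μ.real {ω | B k ω = S} = 1 / (n.choose b : ℝ)

/-- `B_0, B_1, …` are independent uniform mini-batches of size `b`, the coins `i_0, i_1, …` show
`true` with probability `p`, and all these random variables are independent. -/
structure IsSVRGSampling {Ω : Type*} [MeasurableSpace Ω] (μ : Measure Ω) {n : ℕ} (b : ℕ) (p : ℝ)
    (B : ℕ → Ω → Finset (Fin n)) (coin : ℕ → Ω → Bool) : Prop where
  batches : IsMinibatchSampling μ b B
  measurable_coin : ∀ k, Measurable (coin k)
  law_coin : ∀ k, μ.real {ω | coin k ω = true} = p
  indep_pairs : iIndepFun (fun k ω => (B k ω, coin k ω)) μ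
  indep_batch_coin : ∀ k, IndepFun (B k) (coin k) μ

/-! ### Parameters -/

/-- The largest admissible step size: with `Γ = ρ + 2 (Θ + Θ')`, `M = 2 (2Γ - 1) κ` and
`N = 3 Γ κ + 2 (1 - 2ρ)`, it is
`(1/σ) min {3/5, 3ρ / (2 (1 - 2ρ)), 1 / (2κ), 6ρ / (N + √(N² + 12 ρ M))}`. -/
noncomputable def betaBar (σ κ ρ Θ Θ' : ℝ) : ℝ :=
  let Γ := ρ + 2 * (Θ + Θ')
  let M := 2 * (2 * Γ - 1) * κ
  let N := 3 * Γ * κ + 2 * (1 - 2 * ρ)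
  (1 / σ) * min (min (3 / 5) (3 * ρ / (2 * (1 - 2 * ρ))))
    (min (1 / (2 * κ)) (6 * ρ / (N + Real.sqrt (N ^ 2 + 12 * ρ * M))))

/-- The step size for the SVRG estimator, which has `ρ = p/2`, `Θ = (4 - 6p + 3p²) / (b p)` and
`Θ' = 2 (2 - 3p + p²) / (b p)`. -/
noncomputable def svrgBeta (L σ : ℝ) (b : ℕ) (p : ℝ) : ℝ :=
  betaBar σ (L / σ) (p / 2) ((4 - 6 * p + 3 * p ^ 2) / (b * p))
    (2 * (2 - 3 * p + p ^ 2) / (b * p))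

/-- The step size for the SAGA estimator, which has `ρ = b / (2n)`,
`Θ = (2 (n - b) (2n + b) + b²) / (n b²)` and `Θ' = 2 (n - b) (2n + b) / (n b²)`. -/
noncomputable def sagaBeta (L σ : ℝ) (n b : ℕ) : ℝ :=
  betaBar σ (L / σ) (b / (2 * n))
    ((2 * ((n : ℝ) - b) * (2 * n + b) + (b : ℝ) ^ 2) / (n * (b : ℝ) ^ 2))
    (2 * ((n : ℝ) - b) * (2 * n + b) / (n * (b : ℝ) ^ 2))

/-! ### Complexity -/

/-- With an expected number of at most `bound` evaluations, the algorithm reaches an iteration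
`K` from which on `𝔼 ‖x^k - xs‖² ≤ ε²`. Here `x k` is the `k`-th iterate and `T k` the number
of evaluations that are made to compute it. -/
def ReachesWithin {Ω E : Type*} [MeasurableSpace Ω] (μ : Measure Ω) [NormedAddCommGroup E]
    (x : ℕ → Ω → E) (T : ℕ → Ω → ℕ) (xs : E) (ε bound : ℝ) : Prop :=
  ∃ K : ℕ,
    (∀ k, K ≤ k → Integrable (fun ω => ‖x k ω - xs‖ ^ 2) μ ∧
      ∫ ω, ‖x k ω - xs‖ ^ 2 ∂μ ≤ ε ^ 2) ∧
    Integrable (fun ω => (T K ω : ℝ)) μ ∧ ∫ ω, (T K ω : ℝ) ∂μ ≤ bound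

/-! ### Values and costs of oracle computations -/

/-! Write y = x^k - x^⋆, h = ηGx^{k-1}, g = ηGx^k, r = x^k - x^{k-1} + (3/2)h, and let e be η times
the error of the estimator. For θ = 1/3 and γ = 1/2 the old value h cancels from the update: r
becomes r/3 + g/2 - e, and y + r/2 becomes y + r/2 - (3/4)g - (3/2)e. This suggests the quadratic
form `lyap`. Its cross term -(7/8)⟪h, r⟫ makes -(7/8)⟪g - h, x^k - x^{k-1}⟫ appear in the change of
`lyap`, and average cocoercivity turns this into a multiple, of order 1/(ηL), of -η² · mean ‖G_i x^k
- G_i x^{k-1}‖². That surplus pays for the variance of the estimator, while quasi-monotonicity,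
through -⟪g, y⟫, gives the linear rate (`lyap_exact_step_le`, `sum_lyap_step_le`).

Both estimators are unbiased. Their error is the sampling error of the family (G_i x^k - G_i
x^{k-1}) + (1/2)(G_i x^{k-1} - stored value), and a batch of size b divides its mean square by b.
Let p be the refresh probability for SVRG and b/n for SAGA. The mean squared gap between stored
values and values at the previous iterate contracts in expectation by 1 - p/2, up to the same
squared increments. Adding a multiple of the gap to `lyap` therefore gives a function that contracts
by 1 - ησ/24 in conditional expectation (`StepAssumptions.sum_potential_add_le`), and
`integral_recursion_le` iterates this.

By `betaBar_spec` the step size satisfies the smallness conditions needed here, and 1/(ησ) is at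
most of order 1 + 1/p + κ(1 + 1/(bp²)). With b of order n^{2/3} and p at least of order n^{-1/3},
bp² is bounded below, so order (n^{1/3} + κ) · log iterations suffice. Each costs order n^{2/3}
evaluations in expectation, and n^{2/3}(n^{1/3} + κ) ≤ 2 max{n, n^{2/3}κ}. -/

namespace OracleComp

variable {n : ℕ} {E α β : Type}

@[simp] lemma eval_pure (G : Fin n → E → E) (a : α) :
    (pure a : OracleComp n E α).eval G = a := rfl

@[simp] lemma calls_pure (G : Fin n → E → E) (a : α) :
    (pure a : OracleComp n E α).calls G = 0 := rfl

@[simp] lemma eval_bind (G : Fin n → E → E) (m : OracleComp n E α) (f : α → OracleComp n E β) :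
    (m >>= f).eval G = (f (m.eval G)).eval G := by
  change (bind m f).eval G = _
  induction m with
  | done a => rfl
  | query i x cont ih => exact ih (G i x)

@[simp] lemma calls_bind (G : Fin n → E → E) (m : OracleComp n E α) (f : α → OracleComp n E β) :
    (m >>= f).calls G = m.calls G + (f (m.eval G)).calls G := by
  change (bind m f).calls G = _
  induction m with
  | done a => simp [bind, calls, eval]
  | query i x cont ih => simp only [bind, calls, eval, ih (G i x)]; omega

lemma eval_askList [Zero E] (G : Fin n → E → E) (x : E) (l : List (Fin n)) :
    (askList x l).eval G = fun i => if i ∈ l then G i x else 0 := by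
  induction l with
  | nil => funext i; simp [askList, eval]
  | cons j l ih =>
    have h : (askList x (j :: l)).eval G = Function.update ((askList x l).eval G) j (G j x) :=
      eval_bind G (askList x l) (fun g => done (Function.update g j (G j x)))
    rw [h, ih]
    funext i
    by_cases hij : i = j
    · subst hij; simp
    · simp [hij]

lemma calls_askList [Zero E] (G : Fin n → E → E) (x : E) (l : List (Fin n)) :
    (askList x l).calls G = l.length := by
  induction l with
  | nil => rfl
  | cons j l ih =>
    have h : (askList x (j :: l)).calls G = (askList x l).calls G + 0 + 1 :=
      congrArg (· + 1) (calls_bind G (askList x l) (fun g => done (Function.update g j (G j x))))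
    simp [h, ih]

lemma eval_ask [Zero E] (G : Fin n → E → E) (B : Finset (Fin n)) (x : E) :
    (ask B x).eval G = fun i => if i ∈ B then G i x else 0 := by
  simp [ask, eval_askList]

@[simp] lemma calls_ask [Zero E] (G : Fin n → E → E) (B : Finset (Fin n)) (x : E) :
    (ask B x).calls G = B.card := by
  simp [ask, calls_askList]

end OracleComp

/-! ### The two variants as plain recursions on the state, and their evaluation counts. -/

section Runs

variable {n : ℕ} {E : Type} [NormedAddCommGroup E] [InnerProductSpace ℝ E]

@[simp] lemma batchMean_eval_ask (G : Fin n → E → E) (B : Finset (Fin n)) (x : E) :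
    batchMean B ((OracleComp.ask B x).eval G) = batchMean B (fun i => G i x) := by
  unfold batchMean
  congr 1
  refine Finset.sum_congr rfl fun i hi => ?_
  simp [OracleComp.eval_ask, hi]

/-- The new snapshot of the SVRG variant. -/
def svrgSnap (refresh : Bool) (s : SVRGState E) : E := if refresh then s.prev else s.snap

/-- The effect of one SVRG iteration on the stored data when the stored value of the snapshot
is correct. -/
noncomputable def svrgNext (G : Fin n → E → E) (θ γ η : ℝ) (B : Finset (Fin n)) (refresh : Bool)
    (s : SVRGState E) : SVRGState E :=
  let w := svrgSnap refresh s
  ⟨kmUpdate θ η s.cur s.prev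
    ((1 - γ) • (meanOp G w - batchMean B (fun i => G i w)) + batchMean B (fun i => G i s.cur)
      - γ • batchMean B (fun i => G i s.prev)), s.cur, w, meanOp G w⟩

lemma eval_svrgStep (G : Fin n → E → E) (θ γ η : ℝ) (B : Finset (Fin n)) (c : Bool)
    (s : SVRGState E) (hs : s.snapVal = meanOp G s.snap) :
    (svrgStep θ γ η B c s).eval G = svrgNext G θ γ η B c s := by
  cases c <;> simp [svrgStep, svrgNext, svrgSnap, hs, meanOp]

lemma calls_svrgStep (G : Fin n → E → E) (θ γ η : ℝ) (B : Finset (Fin n)) (c : Bool)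
    (s : SVRGState E) :
    (svrgStep θ γ η B c s).calls G = (if c then n else 0) + 3 * B.card := by
  cases c <;> simp [svrgStep] <;> ring

/-- The effect of one SAGA iteration on the stored data. -/
noncomputable def sagaNext (G : Fin n → E → E) (θ γ η : ℝ) (B : Finset (Fin n))
    (s : SAGAState n E) : SAGAState n E :=
  ⟨kmUpdate θ η s.cur s.prev ((1 - γ) • batchMean Finset.univ s.table +
    (batchMean B (fun i => G i s.cur) - γ • batchMean B (fun i => G i s.prev)
      - (1 - γ) • batchMean B s.table)), s.cur,
    fun i => if i ∈ B then G i s.cur else s.table i⟩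

lemma eval_sagaStep (G : Fin n → E → E) (θ γ η : ℝ) (B : Finset (Fin n)) (s : SAGAState n E) :
    (sagaStep θ γ η B s).eval G = sagaNext G θ γ η B s := by
  simp only [sagaStep, sagaNext, OracleComp.eval_bind, OracleComp.eval_pure, batchMean_eval_ask,
    SAGAState.mk.injEq, true_and]
  funext i
  by_cases hi : i ∈ B <;> simp [hi, OracleComp.eval_ask]

lemma calls_sagaStep (G : Fin n → E → E) (θ γ η : ℝ) (B : Finset (Fin n)) (s : SAGAState n E) :
    (sagaStep θ γ η B s).calls G = 2 * B.card := by
  simp [sagaStep]; ring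

lemma eval_svrgRun_zero (G : Fin n → E → E) (θ γ η : ℝ) (B : ℕ → Finset (Fin n)) (c : ℕ → Bool)
    (x₀ : E) : (svrgRun θ γ η B c x₀ 0).eval G = ⟨x₀, x₀, x₀, meanOp G x₀⟩ := by
  simp [svrgRun, svrgInit, meanOp]

/-- The method reuses the stored snapshot value, whereas `svrgNext` recomputes it. This invariant
makes the two agree along every run. -/
lemma eval_svrgRun_snapVal (G : Fin n → E → E) (θ γ η : ℝ) (B : ℕ → Finset (Fin n))
    (c : ℕ → Bool) (x₀ : E) (k : ℕ) :
    ((svrgRun θ γ η B c x₀ k).eval G).snapVal =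
      meanOp G ((svrgRun θ γ η B c x₀ k).eval G).snap := by
  induction k with
  | zero => simp [eval_svrgRun_zero]
  | succ k ih =>
    simp only [svrgRun, OracleComp.eval_bind]
    rw [eval_svrgStep G θ γ η _ _ _ ih]
    rfl

lemma eval_svrgRun_succ (G : Fin n → E → E) (θ γ η : ℝ) (B : ℕ → Finset (Fin n)) (c : ℕ → Bool)
    (x₀ : E) (k : ℕ) : (svrgRun θ γ η B c x₀ (k + 1)).eval G =
      svrgNext G θ γ η (B k) (c k) ((svrgRun θ γ η B c x₀ k).eval G) := by
  rw [← eval_svrgStep G θ γ η _ _ _ (eval_svrgRun_snapVal G θ γ η B c x₀ k)]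
  simp [svrgRun]

lemma calls_svrgRun (G : Fin n → E → E) (θ γ η : ℝ) (B : ℕ → Finset (Fin n)) (c : ℕ → Bool)
    (x₀ : E) (k : ℕ) : (svrgRun θ γ η B c x₀ k).calls G =
      n + ∑ j ∈ Finset.range k, ((if c j then n else 0) + 3 * (B j).card) := by
  induction k with
  | zero => simp [svrgRun, svrgInit]
  | succ k ih =>
    rw [Finset.sum_range_succ, ← add_assoc, ← ih]
    simp [svrgRun, calls_svrgStep]

lemma eval_sagaRun_zero (G : Fin n → E → E) (θ γ η : ℝ) (B : ℕ → Finset (Fin n)) (x₀ : E) :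
    (sagaRun θ γ η B x₀ 0).eval G = ⟨x₀, x₀, fun i => G i x₀⟩ := by
  simp [sagaRun, sagaInit, OracleComp.eval_ask]

lemma eval_sagaRun_succ (G : Fin n → E → E) (θ γ η : ℝ) (B : ℕ → Finset (Fin n)) (x₀ : E)
    (k : ℕ) : (sagaRun θ γ η B x₀ (k + 1)).eval G =
      sagaNext G θ γ η (B k) ((sagaRun θ γ η B x₀ k).eval G) := by
  rw [← eval_sagaStep]
  simp [sagaRun]

lemma calls_sagaRun (G : Fin n → E → E) (θ γ η : ℝ) (B : ℕ → Finset (Fin n)) (x₀ : E) (k : ℕ) :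
    (sagaRun θ γ η B x₀ k).calls G = n + ∑ j ∈ Finset.range k, 2 * (B j).card := by
  induction k with
  | zero => simp [sagaRun, sagaInit]
  | succ k ih =>
    rw [Finset.sum_range_succ, ← add_assoc, ← ih]
    simp [sagaRun, calls_sagaStep]

end Runs

/-! ### Recursions driven by independent random variables with finitely many values -/

section Recursion

/-- The state before draw k depends only on the draws with smaller index. This is what makes it
independent of draw k. -/
lemma exists_eq_comp_history {Ω W S : Type*} {step : W → S → S} {s₀ : S} {ξ : ℕ → Ω → W} {s : ℕ → Ω → S}
    (h0 : ∀ ω, s 0 ω = s₀) (hs : ∀ k ω, s (k + 1) ω = step (ξ k ω) (s k ω)) (k : ℕ) :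
    ∃ F : (Finset.range k → W) → S, ∀ ω, s k ω = F (fun i => ξ i ω) := by
  induction k with
  | zero => exact ⟨fun _ => s₀, h0⟩
  | succ k ih =>
    obtain ⟨F, hF⟩ := ih
    refine ⟨fun w => step (w ⟨k, by simp⟩)
      (F fun i => w ⟨i, Finset.mem_range.2 (by have := Finset.mem_range.1 i.2; omega)⟩), ?_⟩
    intro ω
    rw [hs, hF]

variable {Ω : Type*} [MeasurableSpace Ω] {μ : Measure Ω} [IsProbabilityMeasure μ]
  {W : Type*} [Fintype W] [MeasurableSpace W] [MeasurableSingletonClass W] {S : Type*}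

lemma integrable_comp_of_finite {V : Type*} [Finite V] [MeasurableSpace V]
    [MeasurableSingletonClass V] {Y : Ω → V} (hY : Measurable Y) (f : V → ℝ) :
    Integrable (fun ω => f (Y ω)) μ := by
  obtain ⟨C, hC⟩ := (Set.finite_range fun v => ‖f v‖).bddAbove
  exact Integrable.of_bound ((measurable_of_finite f).comp hY).aestronglyMeasurable C
    (Filter.Eventually.of_forall fun ω => hC ⟨Y ω, rfl⟩)

/-- The history takes finitely many values, so every real function of the state is bounded and
measurable, and no measurable structure on the state space is needed. -/
lemma integrable_recursion {step : W → S → S} {s₀ : S} {ξ : ℕ → Ω → W} {s : ℕ → Ω → S}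
    (hm : ∀ k, Measurable (ξ k))
    (h0 : ∀ ω, s 0 ω = s₀) (hs : ∀ k ω, s (k + 1) ω = step (ξ k ω) (s k ω))
    (f : S → ℝ) (k : ℕ) : Integrable (fun ω => f (s k ω)) μ := by
  obtain ⟨F, hF⟩ := exists_eq_comp_history h0 hs k
  simp only [hF]
  exact integrable_comp_of_finite (Y := fun ω (i : Finset.range k) => ξ i ω)
    (measurable_pi_lambda _ fun i => hm i) (fun v => f (F v))

/-- The tower property in elementary form: split according to the value of the fresh draw, which is
independent of the current state. -/
lemma integral_recursion_succ {step : W → S → S} {s₀ : S} {ξ : ℕ → Ω → W} {s : ℕ → Ω → S}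
    (hm : ∀ k, Measurable (ξ k)) (hi : iIndepFun ξ μ)
    (h0 : ∀ ω, s 0 ω = s₀) (hs : ∀ k ω, s (k + 1) ω = step (ξ k ω) (s k ω))
    (f : S → ℝ) (k : ℕ) :
    ∫ ω, f (s (k + 1) ω) ∂μ = ∫ ω, ∑ w, μ.real {ω | ξ k ω = w} * f (step w (s k ω)) ∂μ := by
  classical
  obtain ⟨F, hF⟩ := exists_eq_comp_history h0 hs k
  have hindep := hi.indepFun_finset (Finset.range k) {k} (by simp) hm
  have hint : ∀ w, Integrable (fun ω => f (step w (s k ω))) μ := fun w =>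
    integrable_recursion hm h0 hs (fun x => f (step w x)) k
  have hind : ∀ w, Integrable (fun ω => if ξ k ω = w then (1 : ℝ) else 0) μ := fun w =>
    integrable_comp_of_finite (hm k) (fun v => if v = w then (1 : ℝ) else 0)
  have hprod : ∀ w, Integrable (fun ω => (if ξ k ω = w then (1 : ℝ) else 0) * f (step w (s k ω))) μ :=
    fun w => by
      refine (hint w).mono ((hind w).aestronglyMeasurable.mul (hint w).aestronglyMeasurable)
        (Filter.Eventually.of_forall fun ω => ?_)
      by_cases h : ξ k ω = w <;> simp [h]
  have hsplit : ∀ ω, f (s (k + 1) ω) =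
      ∑ w, (if ξ k ω = w then (1 : ℝ) else 0) * f (step w (s k ω)) := fun ω => by
    simp [hs]
  simp only [hsplit]
  rw [integral_finsetSum _ fun w _ => hprod w,
    integral_finsetSum _ fun w _ => (hint w).const_mul _]
  refine Finset.sum_congr rfl fun w _ => ?_
  have hw : IndepFun (fun ω => if ξ k ω = w then (1 : ℝ) else 0)
      (fun ω => f (step w (s k ω))) μ := by
    have := (hindep.comp (φ := fun v => f (step w (F v)))
      (ψ := fun v : (({k} : Finset ℕ) → W) => if v ⟨k, by simp⟩ = w then (1 : ℝ) else 0)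
      (measurable_of_finite _) (measurable_of_finite _)).symm
    simpa only [Function.comp_def, hF] using this
  rw [hw.integral_fun_mul_eq_mul_integral (hind w).aestronglyMeasurable
    (hint w).aestronglyMeasurable, integral_const_mul]
  congr 1
  have hset : MeasurableSet {ω | ξ k ω = w} := hm k (measurableSet_singleton w)
  rw [← integral_indicator_one hset]
  rfl

/-- A nonnegative function that contracts in expectation along every step decays geometrically
along the recursion. -/
lemma integral_recursion_le {step : W → S → S} {s₀ : S} {ξ : ℕ → Ω → W} {s : ℕ → Ω → S}
    (hm : ∀ k, Measurable (ξ k)) (hi : iIndepFun ξ μ)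
    (h0 : ∀ ω, s 0 ω = s₀) (hs : ∀ k ω, s (k + 1) ω = step (ξ k ω) (s k ω))
    {q : ℝ} (hq : 0 ≤ q) (f : S → ℝ)
    (hf : ∀ k x, ∑ w, μ.real {ω | ξ k ω = w} * f (step w x) ≤ q * f x) (k : ℕ) :
    ∫ ω, f (s k ω) ∂μ ≤ q ^ k * f s₀ := by
  induction k with
  | zero => simp [h0]
  | succ k ih =>
    rw [integral_recursion_succ hm hi h0 hs f k]
    calc ∫ ω, ∑ w, μ.real {ω | ξ k ω = w} * f (step w (s k ω)) ∂μ
        ≤ ∫ ω, q * f (s k ω) ∂μ :=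
          integral_mono (integrable_recursion hm h0 hs
            (fun x => ∑ w, μ.real {ω | ξ k ω = w} * f (step w x)) k)
            ((integrable_recursion hm h0 hs f k).const_mul q) fun ω => hf k (s k ω)
      _ = q * ∫ ω, f (s k ω) ∂μ := integral_const_mul _ _
      _ ≤ q * (q ^ k * f s₀) := mul_le_mul_of_nonneg_left ih hq
      _ = q ^ (k + 1) * f s₀ := by ring

end Recursion

/-! ### Averages over uniformly distributed subsets -/

section Averages

variable {n : ℕ} {E : Type} [NormedAddCommGroup E] [InnerProductSpace ℝ E]

/-- The probability of `S` under the uniform distribution on the subsets of size `b`. -/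
noncomputable def subsetWeight (n b : ℕ) (S : Finset (Fin n)) : ℝ :=
  if S.card = b then 1 / (n.choose b : ℝ) else 0

lemma subsetWeight_nonneg (b : ℕ) (S : Finset (Fin n)) : 0 ≤ subsetWeight n b S := by
  unfold subsetWeight; split_ifs <;> positivity

lemma sum_subsetWeight_mul (b : ℕ) (f : Finset (Fin n) → ℝ) :
    ∑ S, subsetWeight n b S * f S =
      (1 / (n.choose b : ℝ)) * ∑ S ∈ Finset.powersetCard b Finset.univ, f S := by
  have h : Finset.powersetCard b (Finset.univ : Finset (Fin n)) =
      Finset.univ.filter fun S => S.card = b := by ext S; simp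
  rw [h, Finset.sum_filter, Finset.mul_sum]
  exact Finset.sum_congr rfl fun S _ => by unfold subsetWeight; split_ifs <;> simp

lemma sum_subsetWeight {b : ℕ} (hb : b ≤ n) : ∑ S, subsetWeight n b S = 1 := by
  have h := sum_subsetWeight_mul (n := n) b fun _ => 1
  simp only [mul_one] at h
  have h0 : (n.choose b : ℝ) ≠ 0 := by exact_mod_cast (Nat.choose_pos hb).ne'
  rw [h]
  simp [h0]

/-- All sets of the same size are contained in the random subset with the same probability. -/
lemma sum_subsetWeight_superset_eq {b : ℕ} {s t : Finset (Fin n)} (h : s.card = t.card) :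
    (∑ S, subsetWeight n b S * if s ⊆ S then 1 else 0) =
      ∑ S, subsetWeight n b S * if t ⊆ S then 1 else 0 := by
  rw [sum_subsetWeight_mul, sum_subsetWeight_mul]
  congr 1
  simp only [Finset.sum_boole]
  norm_cast
  by_cases hb : s.card ≤ b
  · rw [Finset.card_filter_powersetCard_subset _ _ _ (Finset.subset_univ _) hb,
      Finset.card_filter_powersetCard_subset _ _ _ (Finset.subset_univ _) (h ▸ hb), h]
  · have hz : ∀ u : Finset (Fin n), u.card = s.card →
        (Finset.powersetCard b (Finset.univ : Finset (Fin n))).filter (u ⊆ ·) = ∅ := fun u hu => by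
      ext S
      simp only [Finset.mem_filter, Finset.mem_powersetCard, Finset.subset_univ, true_and,
        Finset.notMem_empty, iff_false, not_and]
      intro hS hus
      have := Finset.card_le_card hus
      omega
    rw [hz s rfl, hz t h.symm]

/-- Every index belongs to the random subset with probability `b / n`. -/
lemma sum_subsetWeight_mem {b : ℕ} (hb : b ≤ n) (i : Fin n) :
    (∑ S, subsetWeight n b S * if i ∈ S then 1 else 0) = (b : ℝ) / n := by
  have hn : (n : ℝ) ≠ 0 := by exact_mod_cast i.pos.ne'
  -- By symmetry all n membership probabilities agree, and their sum is the expected size b.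
  have hconst : ∀ j, (∑ S, subsetWeight n b S * if j ∈ S then 1 else 0) =
      ∑ S, subsetWeight n b S * if i ∈ S then 1 else 0 := fun j => by
    simpa using sum_subsetWeight_superset_eq (b := b) (s := {j}) (t := {i}) (by simp)
  have hsum : ∑ j : Fin n, (∑ S, subsetWeight n b S * if j ∈ S then 1 else 0) = (b : ℝ) := by
    rw [Finset.sum_comm]
    have : ∀ S, ∑ j : Fin n, (subsetWeight n b S * if j ∈ S then 1 else 0) =
        subsetWeight n b S * b := fun S => by
      rw [← Finset.mul_sum]
      unfold subsetWeight
      split_ifs with h <;> simp [h]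
    simp only [this]
    rw [← Finset.sum_mul, sum_subsetWeight hb, one_mul]
  simp only [hconst] at hsum
  rw [Finset.sum_const, Finset.card_univ, Fintype.card_fin, nsmul_eq_mul] at hsum
  field_simp
  linarith

lemma sum_subsetWeight_sum_mem {b : ℕ} (hb : b ≤ n) (a : Fin n → ℝ) :
    ∑ S, subsetWeight n b S * ∑ i ∈ S, a i = (b : ℝ) / n * ∑ i, a i := by
  have : ∀ S : Finset (Fin n), subsetWeight n b S * ∑ i ∈ S, a i =
      ∑ i, (subsetWeight n b S * if i ∈ S then 1 else 0) * a i := fun S => by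
    simp [Finset.mul_sum]
  simp only [this]
  rw [Finset.sum_comm, Finset.mul_sum]
  refine Finset.sum_congr rfl fun i _ => ?_
  rw [← Finset.sum_mul, sum_subsetWeight_mem hb]

lemma sum_subsetWeight_sum_notMem {b : ℕ} (hb : b ≤ n) (a : Fin n → ℝ) :
    ∑ S, subsetWeight n b S * ∑ i, (if i ∈ S then 0 else a i) =
      (1 - (b : ℝ) / n) * ∑ i, a i := by
  have : ∀ S : Finset (Fin n), ∑ i, (if i ∈ S then 0 else a i) = ∑ i, a i - ∑ i ∈ S, a i :=
    fun S => by
      rw [eq_sub_iff_add_eq, ← Finset.sum_filter_add_sum_filter_not Finset.univ (· ∈ S) a]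
      simp [Finset.sum_filter, add_comm]
  simp only [this, mul_sub, Finset.sum_sub_distrib, sum_subsetWeight_sum_mem hb]
  rw [← Finset.sum_mul, sum_subsetWeight hb]
  ring

lemma batchMean_sub (B : Finset (Fin n)) (f g : Fin n → E) :
    batchMean B (fun i => f i - g i) = batchMean B f - batchMean B g := by
  simp [batchMean, Finset.sum_sub_distrib, smul_sub]

lemma batchMean_smul (B : Finset (Fin n)) (c : ℝ) (f : Fin n → E) :
    batchMean B (fun i => c • f i) = c • batchMean B f := by
  simp only [batchMean, ← Finset.smul_sum]
  rw [smul_comm]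

/-- The mean of `‖f i‖²` over all indices. -/
noncomputable def meanSq (f : Fin n → E) : ℝ := (1 / (n : ℝ)) * ∑ i, ‖f i‖ ^ 2

lemma meanSq_nonneg {F : Type} [NormedAddCommGroup F] (f : Fin n → F) : 0 ≤ meanSq f := by unfold meanSq; positivity

lemma sum_norm_sub_mean_sq (hn : 0 < n) (f : Fin n → E) :
    (1 / (n : ℝ)) * ∑ i, ‖f i - batchMean Finset.univ f‖ ^ 2 =
      meanSq f - ‖batchMean Finset.univ f‖ ^ 2 := by
  have hn' : (n : ℝ) ≠ 0 := by exact_mod_cast hn.ne'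
  set m := batchMean Finset.univ f with hm
  have hs : ∑ i, f i = (n : ℝ) • m := by
    simp [hm, batchMean, smul_smul, hn']
  simp only [norm_sub_sq_real, Finset.sum_add_distrib, Finset.sum_sub_distrib, ← Finset.mul_sum]
  rw [← sum_inner, hs, real_inner_smul_left, real_inner_self_eq_norm_sq]
  simp only [Finset.sum_const, Finset.card_univ, Fintype.card_fin, nsmul_eq_mul, meanSq]
  field_simp
  ring

lemma norm_batchMean_univ_sq_le (hn : 0 < n) (f : Fin n → E) :
    ‖batchMean Finset.univ f‖ ^ 2 ≤ meanSq f := by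
  have h := sum_norm_sub_mean_sq hn f
  have : 0 ≤ (1 / (n : ℝ)) * ∑ i, ‖f i - batchMean Finset.univ f‖ ^ 2 := by positivity
  linarith

/-- The mini-batch mean is an unbiased estimator of the mean. -/
lemma sum_subsetWeight_smul_batchMean {b : ℕ} (hb0 : 0 < b) (hb : b ≤ n) (f : Fin n → E) :
    ∑ S, subsetWeight n b S • batchMean S f = batchMean Finset.univ f := by
  have hb' : (b : ℝ) ≠ 0 := by exact_mod_cast hb0.ne'
  have : ∀ S : Finset (Fin n), subsetWeight n b S • batchMean S f =
      ∑ i, (subsetWeight n b S * if i ∈ S then 1 else 0) • ((b : ℝ)⁻¹ • f i) := fun S => by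
    simp only [mul_ite, mul_one, mul_zero, ite_smul, zero_smul, Finset.sum_ite_mem,
      Finset.univ_inter]
    rw [← Finset.smul_sum, ← Finset.smul_sum, batchMean]
    unfold subsetWeight
    split_ifs with h <;> simp [h]
  simp only [this]
  rw [Finset.sum_comm, batchMean, Finset.smul_sum]
  refine Finset.sum_congr rfl fun i _ => ?_
  rw [← Finset.sum_smul, sum_subsetWeight_mem hb, smul_smul]
  congr 1
  simp
  field_simp

/-- The variance of the mini-batch mean is at most `1 / b` times the mean of the squares. -/
lemma sum_subsetWeight_norm_sq_le {b : ℕ} (hb0 : 0 < b) (hb : b ≤ n) (f : Fin n → E) :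
    ∑ S, subsetWeight n b S * ‖batchMean S f - batchMean Finset.univ f‖ ^ 2 ≤
      (1 / (b : ℝ)) * meanSq f := by
  have hn : 0 < n := hb0.trans_le hb
  have hn' : (n : ℝ) ≠ 0 := by exact_mod_cast hn.ne'
  have hb' : (b : ℝ) ≠ 0 := by exact_mod_cast hb0.ne'
  set m := batchMean Finset.univ f with hm
  set g : Fin n → E := fun i => f i - m with hg
  have hg0 : ∑ i, g i = 0 := by
    simp [hg, hm, batchMean, ← Nat.cast_smul_eq_nsmul ℝ, smul_smul, hn']
  -- A is the common probability that two distinct given indices are both drawn. If there is no such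
  -- pair, any nonnegative value serves.
  obtain ⟨A, hA0, hA⟩ : ∃ A : ℝ, 0 ≤ A ∧ ∀ i j : Fin n, i ≠ j →
      (∑ S, subsetWeight n b S * if {i, j} ⊆ S then 1 else 0) = A := by
    by_cases h : ∃ i j : Fin n, i ≠ j
    · obtain ⟨i₀, j₀, h₀⟩ := h
      refine ⟨_, ?_, fun i j hij => sum_subsetWeight_superset_eq (t := {i₀, j₀}) ?_⟩
      · exact Finset.sum_nonneg fun S _ => mul_nonneg (subsetWeight_nonneg b S)
          (by split_ifs <;> norm_num)
      · rw [Finset.card_pair hij, Finset.card_pair h₀]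
    · exact ⟨0, le_rfl, fun i j hij => absurd ⟨i, j, hij⟩ h⟩
  have hsq : ∀ S : Finset (Fin n), subsetWeight n b S * ‖batchMean S f - m‖ ^ 2 =
      (1 / (b : ℝ) ^ 2) * ∑ i, ∑ j,
        (subsetWeight n b S * if {i, j} ⊆ S then 1 else 0) * inner ℝ (g i) (g j) := fun S => by
    by_cases hS : S.card = b
    · have h1 : batchMean S f - m = (b : ℝ)⁻¹ • ∑ i ∈ S, g i := by
        simp only [hg, Finset.sum_sub_distrib, smul_sub, batchMean, hS, Finset.sum_const]
        rw [← Nat.cast_smul_eq_nsmul ℝ b, smul_smul, inv_mul_cancel₀ hb', one_smul]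
      rw [h1, norm_smul, mul_pow, ← real_inner_self_eq_norm_sq (∑ i ∈ S, g i), sum_inner]
      simp only [inner_sum]
      have h2 : ∑ i, ∑ j, (subsetWeight n b S * if {i, j} ⊆ S then 1 else 0)
          * inner ℝ (g i) (g j) =
          subsetWeight n b S * ∑ i ∈ S, ∑ j ∈ S, inner ℝ (g i) (g j) := by
        rw [Finset.mul_sum, ← Finset.sum_subset (Finset.subset_univ S)]
        · refine Finset.sum_congr rfl fun i hi => ?_
          rw [Finset.mul_sum, ← Finset.sum_subset (Finset.subset_univ S)]
          · refine Finset.sum_congr rfl fun j hj => ?_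
            simp [Finset.insert_subset_iff, hi, hj]
          · intro j _ hj
            simp [Finset.insert_subset_iff, hj]
        · intro i _ hi
          simp [Finset.insert_subset_iff, hi]
      rw [h2]
      simp
      ring
    · simp [subsetWeight, hS]
  have hpair : ∀ i j : Fin n, (∑ S, subsetWeight n b S * if {i, j} ⊆ S then 1 else 0) =
      A + if i = j then (b : ℝ) / n - A else 0 := fun i j => by
    by_cases hij : i = j
    · subst hij
      have := sum_subsetWeight_mem hb i
      simp only [Finset.pair_eq_singleton, Finset.singleton_subset_iff, this]
      simp
    · rw [hA i j hij, if_neg hij, add_zero]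
  -- The constant part A of the pair probabilities multiplies ‖∑ g i‖² = 0, so only the diagonal
  -- excess b/n - A remains. Dropping A ≥ 0 afterwards gives the bound 1/b.
  have htot : ∑ S, subsetWeight n b S * ‖batchMean S f - m‖ ^ 2 =
      (1 / (b : ℝ) ^ 2) * (((b : ℝ) / n - A) * ∑ i, ‖g i‖ ^ 2) := by
    simp only [hsq]
    rw [← Finset.mul_sum]
    congr 1
    rw [Finset.sum_comm]
    have h3 : ∀ i : Fin n, ∑ S, ∑ j, (subsetWeight n b S * if {i, j} ⊆ S then 1 else 0)
        * inner ℝ (g i) (g j) = ((b : ℝ) / n - A) * ‖g i‖ ^ 2 := fun i => by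
      rw [Finset.sum_comm]
      simp only [← Finset.sum_mul, hpair, add_mul, Finset.sum_add_distrib, ite_mul, zero_mul]
      rw [← Finset.mul_sum, ← inner_sum, hg0]
      simp
    simp only [h3]
    rw [← Finset.mul_sum]
  have hvar := sum_norm_sub_mean_sq hn f
  have hsum0 : 0 ≤ ∑ i, ‖g i‖ ^ 2 := by positivity
  rw [htot]
  calc (1 / (b : ℝ) ^ 2) * (((b : ℝ) / n - A) * ∑ i, ‖g i‖ ^ 2)
      ≤ (1 / (b : ℝ) ^ 2) * ((b : ℝ) / n * ∑ i, ‖g i‖ ^ 2) := by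
        gcongr; linarith
    _ = (1 / (b : ℝ)) * (1 / (n : ℝ) * ∑ i, ‖g i‖ ^ 2) := by field_simp
    _ ≤ (1 / (b : ℝ)) * meanSq f := by
        gcongr
        rw [hvar]
        nlinarith [sq_nonneg ‖m‖]

end Averages

/-! ### The laws of the random variables that drive the two variants -/

section Laws

variable {Ω : Type*} [MeasurableSpace Ω] {μ : Measure Ω} [IsProbabilityMeasure μ] {n b : ℕ}
  {B : ℕ → Ω → Finset (Fin n)}

/-- The law is prescribed only on sets of size b. These probabilities already add up to 1, which
forces all other sets to have probability 0. -/
lemma IsMinibatchSampling.real_eq (h : IsMinibatchSampling μ b B) (hb : b ≤ n) (k : ℕ)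
    (S : Finset (Fin n)) : μ.real {ω | B k ω = S} = subsetWeight n b S := by
  by_cases hS : S.card = b
  · rw [h.law k S hS, subsetWeight, if_pos hS]
  · have htot : ∑ S, μ.real {ω | B k ω = S} = 1 := by
      have := sum_measureReal_preimage_singleton (μ := μ) (f := B k) Finset.univ
        (fun y _ => h.measurable k (measurableSet_singleton y))
      rw [Finset.coe_univ, Set.preimage_univ, probReal_univ] at this
      exact this
    have hle : ∀ S, subsetWeight n b S ≤ μ.real {ω | B k ω = S} := fun S => by
      unfold subsetWeight
      split_ifs with hS
      · exact (h.law k S hS).ge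
      · exact measureReal_nonneg
    have heq := (Finset.sum_eq_sum_iff_of_le fun S _ => hle S).1
      ((sum_subsetWeight hb).trans htot.symm)
    exact (heq S (Finset.mem_univ S)).symm

lemma IsMinibatchSampling.ae_card (h : IsMinibatchSampling μ b B) (hb : b ≤ n) (k : ℕ) :
    ∀ᵐ ω ∂μ, (B k ω).card = b := by
  have hz : ∀ S : Finset (Fin n), S.card ≠ b → ∀ᵐ ω ∂μ, B k ω ≠ S := fun S hS => by
    have h0 : μ.real {ω | B k ω = S} = 0 := by rw [h.real_eq hb, subsetWeight, if_neg hS]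
    rw [measureReal_eq_zero_iff] at h0
    simpa [ae_iff] using h0
  have := ae_all_iff.2 fun S : {S : Finset (Fin n) // S.card ≠ b} => hz S.1 S.2
  filter_upwards [this] with ω hω
  by_contra hc
  exact hω ⟨B k ω, hc⟩ rfl

variable {p : ℝ} {coin : ℕ → Ω → Bool}

/-- The probability that a coin which shows `true` with probability `p` shows `c`. -/
def coinWeight (p : ℝ) (c : Bool) : ℝ := if c then p else 1 - p

lemma IsSVRGSampling.real_coin (h : IsSVRGSampling μ b p B coin) (k : ℕ) (c : Bool) :
    μ.real {ω | coin k ω = c} = coinWeight p c := by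
  cases c with
  | true => simpa [coinWeight] using h.law_coin k
  | false =>
    have hc : {ω | coin k ω = false} = {ω | coin k ω = true}ᶜ := by ext ω; simp
    have hm : MeasurableSet {ω | coin k ω = true} := h.measurable_coin k (measurableSet_singleton true)
    rw [hc, probReal_compl_eq_one_sub hm, h.law_coin k]
    simp [coinWeight]

lemma IsSVRGSampling.real_pair (h : IsSVRGSampling μ b p B coin) (hb : b ≤ n) (k : ℕ)
    (w : Finset (Fin n) × Bool) :
    μ.real {ω | (B k ω, coin k ω) = w} = subsetWeight n b w.1 * coinWeight p w.2 := by
  rw [← h.batches.real_eq hb k, ← h.real_coin k]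
  have hs : {ω | (B k ω, coin k ω) = w} = B k ⁻¹' {w.1} ∩ coin k ⁻¹' {w.2} := by
    ext ω; simp [Prod.ext_iff]
  rw [hs, measureReal_def, (h.indep_batch_coin k).measure_inter_preimage_eq_mul _ _
    (measurableSet_singleton _) (measurableSet_singleton _), ENNReal.toReal_mul]
  rfl

end Laws

/-! ### The Lyapunov function -/

section Lyapunov

variable {E : Type} [NormedAddCommGroup E] [InnerProductSpace ℝ E]

/-- A quadratic Lyapunov function of `y = x^k - x^⋆`, `r = x^k - x^{k-1} + (3/2) h` and
`h = η G x^{k-1}`. -/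
noncomputable def lyap (y r h : E) : ℝ :=
  ‖y + (1 / 2 : ℝ) • r‖ ^ 2 + (1 / 2) * ‖r‖ ^ 2 - (7 / 8) * inner ℝ h r + ‖h‖ ^ 2

lemma lyap_le (y r h : E) :
    lyap y r h ≤ 2 * ‖y‖ ^ 2 + (3 / 2) * ‖r‖ ^ 2 + (3 / 2) * ‖h‖ ^ 2 := by
  have h1 : 0 ≤ ‖y - (1 / 2 : ℝ) • r‖ ^ 2 := by positivity
  have h2 : 0 ≤ ‖h + r‖ ^ 2 := by positivity
  have h3 : 0 ≤ ‖r‖ ^ 2 := by positivity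
  have h4 : 0 ≤ ‖h‖ ^ 2 := by positivity
  rw [norm_sub_sq_real, norm_smul, inner_smul_right] at h1
  rw [norm_add_sq_real] at h2
  unfold lyap
  rw [norm_add_sq_real, norm_smul, inner_smul_right]
  norm_num at h1 ⊢
  nlinarith

lemma half_norm_sq_le_lyap (y r h : E) : (1 / 2) * ‖y‖ ^ 2 ≤ lyap y r h := by
  have h1 : 0 ≤ ‖y + r‖ ^ 2 := by positivity
  -- Completing squares: `lyap` equals ‖y‖²/2 + ‖y + r‖²/2 + ‖h - (7/16)r‖² + (1/4 - 49/256)‖r‖².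
  have h2 : 0 ≤ ‖h - (7 / 16 : ℝ) • r‖ ^ 2 := by positivity
  have h3 : 0 ≤ ‖r‖ ^ 2 := by positivity
  rw [norm_add_sq_real] at h1
  rw [norm_sub_sq_real, norm_smul, inner_smul_right] at h2
  unfold lyap
  rw [norm_add_sq_real, norm_smul, inner_smul_right]
  norm_num at h2 ⊢
  nlinarith

/-- The value of the Lyapunov function after a step with estimation error `e`. -/
lemma lyap_step_eq (y r h g e : E) :
    lyap (y + ((1 / 3 : ℝ) • (r - (3 / 2 : ℝ) • h) - g + (1 / 2 : ℝ) • h - e))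
        ((1 / 3 : ℝ) • r + (1 / 2 : ℝ) • g - e) g =
      lyap (y + ((1 / 3 : ℝ) • (r - (3 / 2 : ℝ) • h) - g + (1 / 2 : ℝ) • h))
        ((1 / 3 : ℝ) • r + (1 / 2 : ℝ) • g) g
      + inner ℝ ((21 / 8 : ℝ) • g - (3 : ℝ) • y - (11 / 6 : ℝ) • r) e + (11 / 4) * ‖e‖ ^ 2 := by
  unfold lyap
  simp only [← real_inner_self_eq_norm_sq, inner_add_left, inner_add_right, inner_sub_left,
    inner_sub_right, real_inner_smul_left, real_inner_smul_right, smul_sub, smul_add, smul_smul]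
  rw [real_inner_comm y r, real_inner_comm y h, real_inner_comm y g, real_inner_comm y e,
    real_inner_comm r h, real_inner_comm r g, real_inner_comm r e, real_inner_comm h g,
    real_inner_comm h e, real_inner_comm g e]
  ring

/-- The decrease of the Lyapunov function along an exact step. -/
lemma lyap_exact_step_le (y r h g : E) {ℓ t u : ℝ} (hℓ : 0 < ℓ) (hℓ2 : ℓ ≤ 1 / 2) (ht0 : 0 ≤ t)
    (ht : t ≤ 3 / 5) (hu : ‖g - h‖ ^ 2 ≤ u) (hmono : u ≤ ℓ * inner ℝ (g - h) (r - (3 / 2 : ℝ) • h))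
    (hcoc : ‖g‖ ^ 2 ≤ ℓ * inner ℝ g y) (hquasi : t * ‖y‖ ^ 2 ≤ inner ℝ g y) :
    lyap (y + ((1 / 3 : ℝ) • (r - (3 / 2 : ℝ) • h) - g + (1 / 2 : ℝ) • h))
        ((1 / 3 : ℝ) • r + (1 / 2 : ℝ) • g) g ≤
      (1 - t / 24) * lyap y r h - (7 / 8) * (u / ℓ) + (21 / 32) * u := by
  have hmono' : u / ℓ ≤ inner ℝ (g - h) (r - (3 / 2 : ℝ) • h) := by
    rw [div_le_iff₀ hℓ]; linarith
  have hgy : 0 ≤ (inner ℝ g y : ℝ) := le_trans (by positivity) hquasi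
  -- Since ℓ ≤ 1/2, part of -(3/2)⟪g, y⟫ absorbs (19/32)‖g‖² below; the rest dominates t‖y‖².
  have hcoc' : 2 * ‖g‖ ^ 2 ≤ inner ℝ g y := by nlinarith
  have hup := lyap_le y r h
  have hdecr : t / 24 * lyap y r h ≤
      t / 24 * (2 * ‖y‖ ^ 2 + (3 / 2) * ‖r‖ ^ 2 + (3 / 2) * ‖h‖ ^ 2) :=
    mul_le_mul_of_nonneg_left hup (by positivity)
  have hr : t * ‖r‖ ^ 2 ≤ 3 / 5 * ‖r‖ ^ 2 := by gcongr
  have hh : t * ‖h‖ ^ 2 ≤ 3 / 5 * ‖h‖ ^ 2 := by gcongr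
  have hr0 : 0 ≤ ‖r‖ ^ 2 := by positivity
  have hh0 : 0 ≤ ‖h‖ ^ 2 := by positivity
  have hy0 : 0 ≤ t * ‖y‖ ^ 2 := by positivity
  -- The new ⟪g, r⟫ terms add up to -3/4 + 1/6 - 7/24 = -7/8, which matches the coefficient of the
  -- old ⟪h, r⟫. Hence g and h enter through the difference g - h, paired with r - (3/2)h = x^k -
  -- x^{k-1}.
  have key : lyap (y + ((1 / 3 : ℝ) • (r - (3 / 2 : ℝ) • h) - g + (1 / 2 : ℝ) • h))
        ((1 / 3 : ℝ) • r + (1 / 2 : ℝ) • g) g =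
      lyap y r h - (3 / 2) * inner ℝ g y - (4 / 9) * ‖r‖ ^ 2 - (11 / 32) * ‖h‖ ^ 2
        + (19 / 32) * ‖g‖ ^ 2 - (7 / 8) * inner ℝ (g - h) (r - (3 / 2 : ℝ) • h)
        + (21 / 32) * ‖g - h‖ ^ 2 := by
    unfold lyap
    simp only [← real_inner_self_eq_norm_sq, inner_add_left, inner_add_right, inner_sub_left,
      inner_sub_right, real_inner_smul_left, real_inner_smul_right, smul_sub, smul_add, smul_smul]
    rw [real_inner_comm y r, real_inner_comm y h, real_inner_comm y g,
      real_inner_comm r h, real_inner_comm r g, real_inner_comm h g]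
    ring
  rw [key]
  linarith

/-- The expected Lyapunov function after a step with an unbiased random estimation error. -/
lemma sum_lyap_step_le {W : Type*} [Fintype W] (q : W → ℝ) (hq1 : ∑ w, q w = 1)
    (e : W → E) (he : ∑ w, q w • e w = 0) (y r h g : E) {ℓ t u v : ℝ} (hℓ : 0 < ℓ)
    (hℓ2 : ℓ ≤ 1 / 2) (ht0 : 0 ≤ t)
    (ht : t ≤ 3 / 5) (hu : ‖g - h‖ ^ 2 ≤ u) (hmono : u ≤ ℓ * inner ℝ (g - h) (r - (3 / 2 : ℝ) • h))
    (hcoc : ‖g‖ ^ 2 ≤ ℓ * inner ℝ g y) (hquasi : t * ‖y‖ ^ 2 ≤ inner ℝ g y)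
    (hv : ∑ w, q w * ‖e w‖ ^ 2 ≤ v) :
    ∑ w, q w * lyap (y + ((1 / 3 : ℝ) • (r - (3 / 2 : ℝ) • h) - g + (1 / 2 : ℝ) • h - e w))
        ((1 / 3 : ℝ) • r + (1 / 2 : ℝ) • g - e w) g ≤
      (1 - t / 24) * lyap y r h - (7 / 8) * (u / ℓ) + (21 / 32) * u + (11 / 4) * v := by
  simp only [lyap_step_eq, mul_add, Finset.sum_add_distrib, ← Finset.sum_mul, hq1, one_mul]
  -- The error enters the Lyapunov function through a linear term, which averages to zero, and
  -- through (11/4)‖e‖², where 11/4 = (3/2)² + 1/2.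
  have h1 : ∀ z : E, ∑ w, q w * inner ℝ z (e w) = 0 := fun z => by
    simp only [← real_inner_smul_right]
    rw [← inner_sum, he, inner_zero_right]
  have h2 : ∑ w, q w * ((11 / 4) * ‖e w‖ ^ 2) = (11 / 4) * ∑ w, q w * ‖e w‖ ^ 2 := by
    rw [Finset.mul_sum]
    exact Finset.sum_congr rfl fun w _ => by ring
  rw [h1, h2]
  have := lyap_exact_step_le y r h g hℓ hℓ2 ht0 ht hu hmono hcoc hquasi
  linarith

end Lyapunov

/-! ### Contraction of the Lyapunov function in one iteration -/

section Contraction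

variable {n : ℕ} {E : Type} [NormedAddCommGroup E] [InnerProductSpace ℝ E]

/-- Young's inequality with a free parameter, which is tuned later so that the gap keeps half of its
contraction. -/
lemma meanSq_add_le (f g : Fin n → E) {s : ℝ} (hs : 0 < s) :
    meanSq (fun i => f i + g i) ≤ (1 + 1 / s) * meanSq f + (1 + s) * meanSq g := by
  have key : ∀ i, ‖f i + g i‖ ^ 2 ≤ (1 + 1 / s) * ‖f i‖ ^ 2 + (1 + s) * ‖g i‖ ^ 2 := fun i => by
    have h : 0 ≤ (1 / s) * ‖f i - s • g i‖ ^ 2 := by positivity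
    rw [norm_sub_sq_real, norm_smul, inner_smul_right, Real.norm_of_nonneg hs.le] at h
    rw [norm_add_sq_real]
    have h2 : (1 / s) * (‖f i‖ ^ 2 - 2 * (s * inner ℝ (f i) (g i)) + (s * ‖g i‖) ^ 2) =
        (1 / s) * ‖f i‖ ^ 2 - 2 * inner ℝ (f i) (g i) + s * ‖g i‖ ^ 2 := by field_simp
    linarith
  unfold meanSq
  calc (1 / (n : ℝ)) * ∑ i, ‖f i + g i‖ ^ 2
      ≤ (1 / (n : ℝ)) * ∑ i, ((1 + 1 / s) * ‖f i‖ ^ 2 + (1 + s) * ‖g i‖ ^ 2) := by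
        gcongr with i; exact key i
    _ = _ := by rw [Finset.sum_add_distrib, ← Finset.mul_sum, ← Finset.mul_sum]; ring

lemma meanSq_smul (c : ℝ) (f : Fin n → E) : meanSq (fun i => c • f i) = c ^ 2 * meanSq f := by
  simp only [meanSq, norm_smul, mul_pow, ← Finset.mul_sum, Real.norm_eq_abs, sq_abs]
  ring

/-- The mean of `‖G_i x - G_i y‖²`. -/
noncomputable def meanSqDiff (G : Fin n → E → E) (x y : E) : ℝ := meanSq fun i => G i x - G i y

lemma AverageCocoercive.meanSqDiff_le {G : Fin n → E → E} {L : ℝ} (h : AverageCocoercive G L)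
    (hL : 0 < L) (x y : E) :
    meanSqDiff G x y ≤ L * inner ℝ (meanOp G x - meanOp G y) (x - y) := by
  have h1 := h x y
  rw [← sum_inner, ← real_inner_smul_left, Finset.sum_sub_distrib, smul_sub, div_mul_eq_mul_div,
    one_mul, div_le_iff₀ hL] at h1
  simp only [meanSqDiff, meanSq, meanOp, batchMean, Finset.card_univ, Fintype.card_fin,
    one_div] at h1 ⊢
  linarith

lemma norm_meanOp_sub_sq_le (hn : 0 < n) (G : Fin n → E → E) (x y : E) :
    ‖meanOp G x - meanOp G y‖ ^ 2 ≤ meanSqDiff G x y := by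
  have := norm_batchMean_univ_sq_le hn fun i => G i x - G i y
  rwa [batchMean_sub] at this

/-- The Lyapunov function of two successive iterates. -/
noncomputable def potential (G : Fin n → E → E) (η : ℝ) (xs x xp : E) : ℝ :=
  lyap (x - xs) (x - xp + (3 / 2 : ℝ) • η • meanOp G xp) (η • meanOp G xp)

/-- The assumptions on the problem and on the step size `η`. -/
structure StepAssumptions (G : Fin n → E → E) (L σ η : ℝ) (xs : E) : Prop where
  pos : 0 < n
  L_pos : 0 < L
  σ_pos : 0 < σ
  coc : AverageCocoercive G L
  quasi : StronglyQuasiMonotoneAt (meanOp G) σ xs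
  η_pos : 0 < η
  ηL_le : η * L ≤ 1 / 2
  ησ_le : η * σ ≤ 3 / 5

variable {G : Fin n → E → E} {L σ η : ℝ} {xs : E}

lemma StepAssumptions.sum_potential_le (A : StepAssumptions G L σ η xs) {W : Type*} [Fintype W]
    (q : W → ℝ) (hq1 : ∑ w, q w = 1) (x xp : E) (e : W → E) (he : ∑ w, q w • e w = 0) {v : ℝ}
    (hv : ∑ w, q w * ‖e w‖ ^ 2 ≤ v) :
    ∑ w, q w * potential G η xs
        (kmUpdate (1 / 3) η x xp (meanOp G x - (1 / 2 : ℝ) • meanOp G xp + e w)) x ≤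
      (1 - η * σ / 24) * potential G η xs x xp
        + η ^ 2 * ((21 / 32 - (7 / 8) * (1 / (η * L))) * meanSqDiff G x xp + (11 / 4) * v) := by
  have hη := A.η_pos
  have hL := A.L_pos
  have hσ := A.σ_pos
  have hmean := A.coc.meanSqDiff_le hL x xp
  have hcoc := (norm_meanOp_sub_sq_le A.pos G x xs).trans (A.coc.meanSqDiff_le hL x xs)
  have hquasi := A.quasi.2 x
  rw [A.quasi.1, sub_zero] at hcoc
  have key := sum_lyap_step_le q hq1 (fun w => η • e w)
    (by simp only [smul_comm _ η, ← Finset.smul_sum, he, smul_zero])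
    (x - xs) (x - xp + (3 / 2 : ℝ) • η • meanOp G xp) (η • meanOp G xp) (η • meanOp G x)
    (ℓ := η * L) (t := η * σ) (u := η ^ 2 * meanSqDiff G x xp) (v := η ^ 2 * v)
    (by positivity) A.ηL_le (by positivity) A.ησ_le
    (by
      rw [← smul_sub, norm_smul, mul_pow, Real.norm_eq_abs, sq_abs]
      gcongr
      exact norm_meanOp_sub_sq_le A.pos G x xp)
    (by
      rw [← smul_sub, real_inner_smul_left, add_sub_cancel_right]
      calc η ^ 2 * meanSqDiff G x xp
          ≤ η ^ 2 * (L * inner ℝ (meanOp G x - meanOp G xp) (x - xp)) := by gcongr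
        _ = _ := by ring)
    (by
      rw [norm_smul, mul_pow, Real.norm_eq_abs, sq_abs, real_inner_smul_left]
      calc η ^ 2 * ‖meanOp G x‖ ^ 2 ≤ η ^ 2 * (L * inner ℝ (meanOp G x) (x - xs)) := by gcongr
        _ = _ := by ring)
    (by
      rw [real_inner_smul_left, mul_assoc]
      gcongr)
    (by
      calc ∑ w, q w * ‖η • e w‖ ^ 2 = η ^ 2 * ∑ w, q w * ‖e w‖ ^ 2 := by
            rw [Finset.mul_sum]
            refine Finset.sum_congr rfl fun w _ => ?_
            rw [norm_smul, mul_pow, Real.norm_eq_abs, sq_abs]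
            ring
        _ ≤ _ := by gcongr)
  have hpot : ∀ w, potential G η xs
        (kmUpdate (1 / 3) η x xp (meanOp G x - (1 / 2 : ℝ) • meanOp G xp + e w)) x =
      lyap (x - xs + ((1 / 3 : ℝ) • (x - xp + (3 / 2 : ℝ) • η • meanOp G xp
          - (3 / 2 : ℝ) • η • meanOp G xp) - η • meanOp G x
          + (1 / 2 : ℝ) • η • meanOp G xp - η • e w))
        ((1 / 3 : ℝ) • (x - xp + (3 / 2 : ℝ) • η • meanOp G xp)
          + (1 / 2 : ℝ) • η • meanOp G x - η • e w) (η • meanOp G x) := fun w => by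
    unfold potential kmUpdate
    congr 1 <;> module
  simp only [hpot]
  refine key.trans (le_of_eq ?_)
  unfold potential
  ring

/-- One iteration with an unbiased estimator whose variance is controlled by a quantity `P` that
contracts up to the squared increments of the `G_i`. -/
lemma StepAssumptions.sum_potential_add_le (A : StepAssumptions G L σ η xs) {W : Type*}
    [Fintype W] (q : W → ℝ) (hq1 : ∑ w, q w = 1) (x xp : E) (e : W → E)
    (he : ∑ w, q w • e w = 0) {α β χ ρ P : ℝ} {P' : W → ℝ} (hβ : 0 ≤ β) (hρ : 0 < ρ) (hα : 0 ≤ α)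
    (hP : 0 ≤ P) (hσρ : η * σ ≤ 3 * ρ) (hν : 4 * (η * L) * (α + β * χ / ρ) ≤ 1 - η * L)
    (hv : ∑ w, q w * ‖e w‖ ^ 2 ≤ α * meanSqDiff G x xp + β * P)
    (hP' : ∑ w, q w * P' w ≤ (1 - ρ) * P + χ * meanSqDiff G x xp) :
    ∑ w, q w * (potential G η xs
        (kmUpdate (1 / 3) η x xp (meanOp G x - (1 / 2 : ℝ) • meanOp G xp + e w)) x
          + (22 / 7) * (β / ρ) * η ^ 2 * P' w) ≤
      (1 - η * σ / 24) * (potential G η xs x xp + (22 / 7) * (β / ρ) * η ^ 2 * P) := by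
  have hη := A.η_pos
  have hL := A.L_pos
  have hU : 0 ≤ meanSqDiff G x xp := meanSq_nonneg _
  have key := A.sum_potential_le q hq1 x xp e he hv
  have hsum : ∑ w, q w * (potential G η xs
        (kmUpdate (1 / 3) η x xp (meanOp G x - (1 / 2 : ℝ) • meanOp G xp + e w)) x
          + (22 / 7) * (β / ρ) * η ^ 2 * P' w) =
      ∑ w, q w * potential G η xs
        (kmUpdate (1 / 3) η x xp (meanOp G x - (1 / 2 : ℝ) • meanOp G xp + e w)) x +
      (22 / 7) * (β / ρ) * η ^ 2 * ∑ w, q w * P' w := by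
    rw [Finset.mul_sum, ← Finset.sum_add_distrib]
    exact Finset.sum_congr rfl fun w _ => by ring
  rw [hsum]
  have hP2 : (22 / 7) * (β / ρ) * η ^ 2 * ∑ w, q w * P' w ≤
      (22 / 7) * (β / ρ) * η ^ 2 * ((1 - ρ) * P + χ * meanSqDiff G x xp) := by gcongr
  have hℓ : 0 < η * L := by positivity
  -- The cocoercivity surplus covers all increment terms: `hν` bounds α + βχ/ρ by (1/(ηL) - 1)/4,
  -- and (22/7)/4 = 11/14 is smaller than 7/8 and larger than 21/32.
  have hcoef : 21 / 32 - (7 / 8) * (1 / (η * L)) + (11 / 4) * α + (22 / 7) * (β * χ / ρ) ≤ 0 := by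
    have h1 : 4 * (α + β * χ / ρ) ≤ 1 / (η * L) - 1 := by
      rw [le_sub_iff_add_le, le_div_iff₀ hℓ]
      linarith
    have h2 : 2 ≤ 1 / (η * L) := by
      rw [le_div_iff₀ hℓ]
      linarith [A.ηL_le]
    linarith
  have hc1 : η ^ 2 * meanSqDiff G x xp * (21 / 32 - (7 / 8) * (1 / (η * L)) + (11 / 4) * α
      + (22 / 7) * (β * χ / ρ)) ≤ 0 := mul_nonpos_of_nonneg_of_nonpos (by positivity) hcoef
  -- The weight 22/7 satisfies (7/8)(22/7) = 11/4: seven eighths of the contraction ρ of P pay for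
  -- the noise (11/4)βP, and the remaining ρ/8 is at least ησ/24 because ησ ≤ 3ρ.
  have hc2 : η ^ 2 * P * (22 / 7 * (β / ρ)) * (η * σ / 24 - ρ / 8) ≤ 0 :=
    mul_nonpos_of_nonneg_of_nonpos (by positivity) (by linarith)
  have e1 : (β / ρ) * ρ = β := by field_simp
  have e2 : β * χ / ρ = (β / ρ) * χ := by ring
  rw [e2] at hc1
  have e3 : η ^ 2 * P * (22 / 7 * (β / ρ)) * (ρ / 8) = η ^ 2 * P * (11 / 28) * β := by
    linear_combination (η ^ 2 * P * (11 / 28)) * e1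
  have e4 : (22 / 7) * (β / ρ) * η ^ 2 * ((1 - ρ) * P) =
      (22 / 7) * (β / ρ) * η ^ 2 * P - (22 / 7) * η ^ 2 * P * β := by
    linear_combination (-(22 / 7) * η ^ 2 * P) * e1
  nlinarith

/-! ### One-step contraction for SVRG. -/

/-- The squared distance of the snapshot values from the values at the previous iterate. -/
noncomputable def svrgGap (G : Fin n → E → E) (s : SVRGState E) : ℝ := meanSqDiff G s.prev s.snap

/-- The Lyapunov function of the SVRG variant. -/
noncomputable def svrgLyap (G : Fin n → E → E) (η : ℝ) (b : ℕ) (p : ℝ) (xs : E)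
    (s : SVRGState E) : ℝ :=
  potential G η xs s.cur s.prev +
    (22 / 7) * ((1 - p) / (2 * b) / (p / 2)) * η ^ 2 * svrgGap G s

lemma StepAssumptions.sum_svrgLyap_le (A : StepAssumptions G L σ η xs) {b : ℕ} {p : ℝ}
    (hb0 : 0 < b) (hb : b ≤ n) (hp0 : 0 < p) (hp1 : p < 1) (hσρ : η * σ ≤ 3 * (p / 2))
    (hν : 4 * (η * L) * ((2 - p) / b
      + (1 - p) / (2 * b) * ((2 - 3 * p + 2 * p ^ 2) / p) / (p / 2)) ≤ 1 - η * L)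
    (s : SVRGState E) :
    ∑ w : Finset (Fin n) × Bool, subsetWeight n b w.1 * coinWeight p w.2 *
        svrgLyap G η b p xs (svrgNext G (1 / 3) (1 / 2) η w.1 w.2 s) ≤
      (1 - η * σ / 24) * svrgLyap G η b p xs s := by
  have hb' : (0 : ℝ) < b := by exact_mod_cast hb0
  -- The estimator is the batch mean of this family plus (1/2)Gw, so its error is exactly the
  -- sampling error of the family.
  set X : Bool → Fin n → E := fun c i =>
    G i s.cur - (1 / 2 : ℝ) • G i s.prev - (1 / 2 : ℝ) • G i (svrgSnap c s) with hX
  set e : Finset (Fin n) × Bool → E := fun w =>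
    batchMean w.1 (X w.2) - batchMean Finset.univ (X w.2) with he
  have hXt : meanSq (X true) = meanSqDiff G s.cur s.prev := by
    unfold meanSqDiff
    congr 1
    funext i
    simp only [hX, svrgSnap, if_true]
    module
  have hXf : meanSq (X false) ≤ 2 * meanSqDiff G s.cur s.prev + (1 / 2) * svrgGap G s := by
    have h := meanSq_add_le (fun i => G i s.cur - G i s.prev)
      (fun i => (1 / 2 : ℝ) • (G i s.prev - G i s.snap)) one_pos
    rw [meanSq_smul] at h
    have hcongr : X false = fun i => G i s.cur - G i s.prev +
        (1 / 2 : ℝ) • (G i s.prev - G i s.snap) := by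
      funext i
      simp only [hX, svrgSnap]
      norm_num
      module
    rw [hcongr]
    refine h.trans (le_of_eq ?_)
    unfold meanSqDiff svrgGap meanSqDiff
    ring
  -- The parameter s = p/(2(1-p)) gives (1-p)(1+s) = 1 - p/2: half of the refresh probability
  -- survives as contraction, the other half pays for moving the reference point from x^{k-1} to
  -- x^k.
  have hgap : meanSqDiff G s.cur s.snap ≤
      ((2 - p) / p) * meanSqDiff G s.cur s.prev + ((2 - p) / (2 * (1 - p))) * svrgGap G s := by
    have hp' : 0 < 1 - p := by linarith
    have h := meanSq_add_le (fun i => G i s.cur - G i s.prev)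
      (fun i => G i s.prev - G i s.snap) (s := p / (2 * (1 - p))) (by positivity)
    simp only [sub_add_sub_cancel] at h
    have e1 : 1 + 1 / (p / (2 * (1 - p))) = (2 - p) / p := by field_simp; ring
    have e2 : 1 + p / (2 * (1 - p)) = (2 - p) / (2 * (1 - p)) := by field_simp; ring
    rw [e1, e2] at h
    exact h
  have hsplit : ∀ f : Finset (Fin n) × Bool → ℝ,
      ∑ w : Finset (Fin n) × Bool, subsetWeight n b w.1 * coinWeight p w.2 * f w =
        p * ∑ S, subsetWeight n b S * f (S, true) +
          (1 - p) * ∑ S, subsetWeight n b S * f (S, false) := fun f => by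
    rw [Fintype.sum_prod_type]
    simp only [Fintype.sum_bool, coinWeight, Finset.sum_add_distrib, Finset.mul_sum]
    congr 1 <;> refine Finset.sum_congr rfl fun S _ => ?_
    · simp; ring
    · simp; ring
  have hq1 : ∑ w : Finset (Fin n) × Bool, subsetWeight n b w.1 * coinWeight p w.2 = 1 := by
    have := hsplit fun _ => 1
    simp only [mul_one, sum_subsetWeight hb] at this
    rw [this]; ring
  have hvar : ∑ w : Finset (Fin n) × Bool, subsetWeight n b w.1 * coinWeight p w.2 * ‖e w‖ ^ 2 ≤
      (2 - p) / b * meanSqDiff G s.cur s.prev + (1 - p) / (2 * b) * svrgGap G s := by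
    rw [hsplit]
    have h1 := sum_subsetWeight_norm_sq_le hb0 hb (X true)
    have h2 := (sum_subsetWeight_norm_sq_le hb0 hb (X false)).trans
      (mul_le_mul_of_nonneg_left hXf (by positivity))
    rw [hXt] at h1
    calc _ ≤ p * (1 / b * meanSqDiff G s.cur s.prev) + (1 - p) *
          (1 / b * (2 * meanSqDiff G s.cur s.prev + 1 / 2 * svrgGap G s)) := by
          have : 0 ≤ 1 - p := by linarith
          gcongr
      _ = _ := by field_simp; ring
  have hmean : ∑ w : Finset (Fin n) × Bool, (subsetWeight n b w.1 * coinWeight p w.2) • e w = 0 := by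
    rw [Fintype.sum_prod_type, Finset.sum_comm]
    refine Finset.sum_eq_zero fun c _ => ?_
    have h1 := sum_subsetWeight_smul_batchMean hb0 hb (X c)
    simp only [he, mul_comm _ (coinWeight p c), mul_smul, ← Finset.smul_sum, smul_sub,
      Finset.sum_sub_distrib, h1]
    rw [← Finset.sum_smul, sum_subsetWeight hb, one_smul, sub_self]
  have hP' : ∑ w : Finset (Fin n) × Bool, subsetWeight n b w.1 * coinWeight p w.2 *
      svrgGap G (svrgNext G (1 / 3) (1 / 2) η w.1 w.2 s) ≤
      (1 - p / 2) * svrgGap G s + (2 - 3 * p + 2 * p ^ 2) / p * meanSqDiff G s.cur s.prev := by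
    rw [hsplit]
    simp only [svrgGap, svrgNext, svrgSnap, if_true, Bool.false_eq_true, if_false]
    simp only [← Finset.sum_mul, sum_subsetWeight hb]
    have hp' : 0 < 1 - p := by linarith
    calc _ ≤ p * (1 * meanSqDiff G s.cur s.prev) + (1 - p) * (1 *
          (((2 - p) / p) * meanSqDiff G s.cur s.prev
            + ((2 - p) / (2 * (1 - p))) * svrgGap G s)) := by
          gcongr
      _ = _ := by unfold svrgGap; field_simp; ring
  have key := A.sum_potential_add_le _ hq1 s.cur s.prev e hmean
    (P' := fun w => svrgGap G (svrgNext G (1 / 3) (1 / 2) η w.1 w.2 s))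
    (div_nonneg (by linarith) (by positivity)) (by positivity)
    (div_nonneg (by linarith) (by positivity)) (meanSq_nonneg _) hσρ hν hvar hP'
  have hcur : ∀ w : Finset (Fin n) × Bool,
      kmUpdate (1 / 3) η s.cur s.prev (meanOp G s.cur - (1 / 2 : ℝ) • meanOp G s.prev + e w) =
        (svrgNext G (1 / 3) (1 / 2) η w.1 w.2 s).cur := fun w => by
    simp only [he, hX, svrgNext, batchMean_sub, batchMean_smul]
    congr 1
    unfold meanOp
    module
  simp only [hcur] at key
  exact key

/-! ### One-step contraction for SAGA. -/

/-- The squared distance of the table from the values at the previous iterate. -/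
noncomputable def sagaGap (G : Fin n → E → E) (s : SAGAState n E) : ℝ :=
  meanSq fun i => G i s.prev - s.table i

/-- The Lyapunov function of the SAGA variant. -/
noncomputable def sagaLyap (G : Fin n → E → E) (η : ℝ) (b : ℕ) (xs : E)
    (s : SAGAState n E) : ℝ :=
  potential G η xs s.cur s.prev +
    (22 / 7) * (1 / (2 * b) / ((b : ℝ) / (2 * n))) * η ^ 2 * sagaGap G s

lemma StepAssumptions.sum_sagaLyap_le (A : StepAssumptions G L σ η xs) {b : ℕ}
    (hb0 : 0 < b) (hb : b < n) (hσρ : η * σ ≤ 3 * ((b : ℝ) / (2 * n)))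
    (hν : 4 * (η * L) * (2 / b
      + 1 / (2 * b) * ((1 - (b : ℝ) / n) * (2 - (b : ℝ) / n) / ((b : ℝ) / n)) / ((b : ℝ) / (2 * n)))
        ≤ 1 - η * L)
    (s : SAGAState n E) :
    ∑ S : Finset (Fin n), subsetWeight n b S *
        sagaLyap G η b xs (sagaNext G (1 / 3) (1 / 2) η S s) ≤
      (1 - η * σ / 24) * sagaLyap G η b xs s := by
  have hb' : (0 : ℝ) < b := by exact_mod_cast hb0
  have hn' : (0 : ℝ) < n := by exact_mod_cast A.pos
  have hbn : (b : ℝ) / n < 1 := by rw [div_lt_one hn']; exact_mod_cast hb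
  have hbn0 : 0 < (b : ℝ) / n := by positivity
  set p : ℝ := (b : ℝ) / n with hp
  have hpρ : (b : ℝ) / (2 * n) = p / 2 := by rw [hp]; ring
  set X : Fin n → E := fun i =>
    G i s.cur - (1 / 2 : ℝ) • G i s.prev - (1 / 2 : ℝ) • s.table i with hX
  set e : Finset (Fin n) → E := fun S => batchMean S X - batchMean Finset.univ X with he
  have hXf : meanSq X ≤ 2 * meanSqDiff G s.cur s.prev + (1 / 2) * sagaGap G s := by
    have h := meanSq_add_le (fun i => G i s.cur - G i s.prev)
      (fun i => (1 / 2 : ℝ) • (G i s.prev - s.table i)) one_pos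
    rw [meanSq_smul] at h
    have hcongr : X = fun i => G i s.cur - G i s.prev +
        (1 / 2 : ℝ) • (G i s.prev - s.table i) := by
      funext i
      simp only [hX]
      module
    rw [hcongr]
    refine h.trans (le_of_eq ?_)
    unfold meanSqDiff sagaGap
    ring
  have hgap : meanSq (fun i => G i s.cur - s.table i) ≤
      ((2 - p) / p) * meanSqDiff G s.cur s.prev + ((2 - p) / (2 * (1 - p))) * sagaGap G s := by
    have hp' : 0 < 1 - p := by linarith
    have h := meanSq_add_le (fun i => G i s.cur - G i s.prev)
      (fun i => G i s.prev - s.table i) (s := p / (2 * (1 - p))) (by positivity)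
    simp only [sub_add_sub_cancel] at h
    have e1 : 1 + 1 / (p / (2 * (1 - p))) = (2 - p) / p := by field_simp; ring
    have e2 : 1 + p / (2 * (1 - p)) = (2 - p) / (2 * (1 - p)) := by field_simp; ring
    rw [e1, e2] at h
    exact h
  have hvar : ∑ S, subsetWeight n b S * ‖e S‖ ^ 2 ≤
      2 / b * meanSqDiff G s.cur s.prev + 1 / (2 * b) * sagaGap G s := by
    refine ((sum_subsetWeight_norm_sq_le hb0 hb.le X).trans
      (mul_le_mul_of_nonneg_left hXf (by positivity))).trans (le_of_eq ?_)
    field_simp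
  have hmean : ∑ S, subsetWeight n b S • e S = 0 := by
    have h1 := sum_subsetWeight_smul_batchMean hb0 hb.le X
    simp only [he, smul_sub, Finset.sum_sub_distrib, h1]
    rw [← Finset.sum_smul, sum_subsetWeight hb.le, one_smul, sub_self]
  -- The new gap is measured at x^k, where refreshed entries contribute nothing; each index is
  -- missed with probability 1 - p = 1 - b/n.
  have hP' : ∑ S, subsetWeight n b S * sagaGap G (sagaNext G (1 / 3) (1 / 2) η S s) ≤
      (1 - p / 2) * sagaGap G s + (1 - p) * (2 - p) / p * meanSqDiff G s.cur s.prev := by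
    have h1 : ∀ S, subsetWeight n b S * sagaGap G (sagaNext G (1 / 3) (1 / 2) η S s) =
        (1 / (n : ℝ)) * (subsetWeight n b S *
          ∑ i, if i ∈ S then 0 else ‖G i s.cur - s.table i‖ ^ 2) := fun S => by
      have : ∀ i, ‖G i s.cur - if i ∈ S then G i s.cur else s.table i‖ ^ 2 =
          if i ∈ S then 0 else ‖G i s.cur - s.table i‖ ^ 2 := fun i => by
        split_ifs <;> simp
      simp only [sagaGap, sagaNext, meanSq, this]
      ring
    simp only [h1]
    rw [← Finset.mul_sum, sum_subsetWeight_sum_notMem hb.le]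
    have hp' : 0 < 1 - p := by linarith
    calc (1 / (n : ℝ)) * ((1 - p) * ∑ i, ‖G i s.cur - s.table i‖ ^ 2)
        = (1 - p) * meanSq (fun i => G i s.cur - s.table i) := by unfold meanSq; ring
      _ ≤ (1 - p) * (((2 - p) / p) * meanSqDiff G s.cur s.prev
            + ((2 - p) / (2 * (1 - p))) * sagaGap G s) := by gcongr
      _ = _ := by field_simp; ring
  have key := A.sum_potential_add_le (subsetWeight n b) (sum_subsetWeight hb.le) s.cur s.prev e
    hmean (P' := fun S => sagaGap G (sagaNext G (1 / 3) (1 / 2) η S s)) (ρ := p / 2)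
    (by positivity) (by positivity) (by positivity) (meanSq_nonneg _) (by rw [← hpρ]; exact hσρ)
    (by rw [← hpρ]; exact hν) hvar hP'
  have hcur : ∀ S : Finset (Fin n),
      kmUpdate (1 / 3) η s.cur s.prev (meanOp G s.cur - (1 / 2 : ℝ) • meanOp G s.prev + e S) =
        (sagaNext G (1 / 3) (1 / 2) η S s).cur := fun S => by
    simp only [he, hX, sagaNext, batchMean_sub, batchMean_smul]
    congr 1
    unfold meanOp
    module
  simp only [hcur] at key
  unfold sagaLyap
  rw [hpρ]
  exact key

/-- The Lyapunov function at the start. -/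
lemma StepAssumptions.potential_init_le (A : StepAssumptions G L σ η xs) (x₀ : E) :
    potential G η xs x₀ x₀ ≤ 4 * ‖x₀ - xs‖ ^ 2 := by
  have hη := A.η_pos
  have hL := A.L_pos
  have hcoc := (norm_meanOp_sub_sq_le A.pos G x₀ xs).trans (A.coc.meanSqDiff_le hL x₀ xs)
  rw [A.quasi.1, sub_zero] at hcoc
  have hcs := real_inner_le_norm (meanOp G x₀) (x₀ - xs)
  have hnorm : ‖meanOp G x₀‖ ≤ L * ‖x₀ - xs‖ := by
    by_contra hlt
    push Not at hlt
    have h1 : 0 < ‖meanOp G x₀‖ := lt_of_le_of_lt (by positivity) hlt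
    have h2 : L * inner ℝ (meanOp G x₀) (x₀ - xs) ≤ L * (‖meanOp G x₀‖ * ‖x₀ - xs‖) := by gcongr
    nlinarith
  have hh : ‖η • meanOp G x₀‖ ≤ (1 / 2) * ‖x₀ - xs‖ := by
    rw [norm_smul, Real.norm_of_nonneg hη.le]
    calc η * ‖meanOp G x₀‖ ≤ η * (L * ‖x₀ - xs‖) := by gcongr
      _ = (η * L) * ‖x₀ - xs‖ := by ring
      _ ≤ _ := by gcongr; exact A.ηL_le
  have hh2 : ‖η • meanOp G x₀‖ ^ 2 ≤ (1 / 4) * ‖x₀ - xs‖ ^ 2 := by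
    calc ‖η • meanOp G x₀‖ ^ 2 ≤ ((1 / 2) * ‖x₀ - xs‖) ^ 2 := by gcongr
      _ = _ := by ring
  unfold potential
  -- Because x^{-1} = x^0, here r = (3/2)h, and ‖h‖ is at most half the initial distance.
  rw [sub_self, zero_add]
  refine (lyap_le _ _ _).trans ?_
  rw [norm_smul, mul_pow]
  norm_num
  nlinarith [sq_nonneg ‖x₀ - xs‖]

lemma norm_sq_le_potential (η : ℝ) (xs x xp : E) :
    ‖x - xs‖ ^ 2 ≤ 2 * potential G η xs x xp := by
  have := half_norm_sq_le_lyap (x - xs) (x - xp + (3 / 2 : ℝ) • η • meanOp G xp) (η • meanOp G xp)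
  unfold potential
  linarith

end Contraction

/-! ### The step size -/

section StepSize

variable {σ κ ρ Θ Θ' : ℝ}

/-- The properties of the step size: it is positive, it satisfies the four constraints (the last
one in a simplified form), and it is not too small. -/
lemma betaBar_spec (hσ : 0 < σ) (hκ : 0 < κ) (hρ : 0 < ρ) (hρ2 : ρ < 1 / 2) (hΘ : 0 ≤ Θ + Θ') :
    0 < betaBar σ κ ρ Θ Θ' ∧ betaBar σ κ ρ Θ Θ' * σ ≤ 3 / 5 ∧
      betaBar σ κ ρ Θ Θ' * σ ≤ 3 * ρ ∧ κ * (betaBar σ κ ρ Θ Θ' * σ) ≤ 1 / 2 ∧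
      2 * (κ * (betaBar σ κ ρ Θ Θ' * σ)) * (Θ + Θ') ≤
        ρ * (1 - κ * (betaBar σ κ ρ Θ Θ' * σ)) ∧
      1 / (betaBar σ κ ρ Θ Θ' * σ) ≤ 3 + 2 / ρ + κ * (3 + 2 * ((Θ + Θ') / ρ)) := by
  set T := Θ + Θ' with hT
  set Γ := ρ + 2 * T with hΓ
  set M := 2 * (2 * Γ - 1) * κ with hM
  set N := 3 * Γ * κ + 2 * (1 - 2 * ρ) with hN
  set R := Real.sqrt (N ^ 2 + 12 * ρ * M) with hR
  set t := min (min (3 / 5) (3 * ρ / (2 * (1 - 2 * ρ)))) (min (1 / (2 * κ)) (6 * ρ / (N + R)))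
    with ht
  have hbeta : betaBar σ κ ρ Θ Θ' * σ = t := by
    have : betaBar σ κ ρ Θ Θ' = (1 / σ) * t := rfl
    rw [this]; field_simp
  have hρ' : 0 < 1 - 2 * ρ := by linarith
  have hΓρ : ρ ≤ Γ := by linarith
  have hΓ0 : 0 < Γ := by linarith
  have hN0 : 0 < N := by positivity
  have hR0 : 0 ≤ R := Real.sqrt_nonneg _
  have hD : 0 ≤ N ^ 2 + 12 * ρ * M := by
    have h1 : 0 ≤ (3 * Γ * κ - 2 * (1 - 2 * ρ)) ^ 2 := sq_nonneg _
    have h2 : 0 ≤ κ * (Γ - ρ) := mul_nonneg hκ.le (by linarith)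
    have : N ^ 2 + 12 * ρ * M = (3 * Γ * κ - 2 * (1 - 2 * ρ)) ^ 2 + 24 * (κ * (Γ - ρ)) := by
      rw [hN, hM]; ring
    linarith
  have hR2 : R ^ 2 = N ^ 2 + 12 * ρ * M := Real.sq_sqrt hD
  have hNR : 0 < N + R := by linarith
  have ht0 : 0 < t := by
    simp only [ht, lt_min_iff]
    refine ⟨⟨by norm_num, by positivity⟩, by positivity, by positivity⟩
  have ht1 : t ≤ 3 / 5 := (min_le_left _ _).trans (min_le_left _ _)
  have ht2 : t ≤ 3 * ρ / (2 * (1 - 2 * ρ)) := (min_le_left _ _).trans (min_le_right _ _)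
  have ht3 : t ≤ 1 / (2 * κ) := (min_le_right _ _).trans (min_le_left _ _)
  have ht4 : t ≤ 6 * ρ / (N + R) := (min_le_right _ _).trans (min_le_right _ _)
  have htρ : t ≤ 3 * ρ := by
    rcases le_or_gt ρ (1 / 4) with h | h
    · refine ht2.trans (div_le_self (by positivity) (by linarith))
    · linarith
  have hκt : κ * t ≤ 1 / 2 := by
    rw [le_div_iff₀ (by positivity)] at ht3
    linarith
  have hκt0 : 0 < κ * t := by positivity
  -- The fourth entry of the minimum is a root of Mt² + Nt = 3ρ in rationalized form, which is
  -- meaningful for every sign of M. The factorization of the quadratic uses 12ρM = R² - N².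
  have hquad : M * t ^ 2 + N * t ≤ 3 * ρ := by
    rw [le_div_iff₀ hNR] at ht4
    have hfac : 12 * ρ * (M * t ^ 2 + N * t - 3 * ρ) =
        (R * t + (6 * ρ - N * t)) * (R * t + N * t - 6 * ρ) := by
      have : 12 * ρ * M = R ^ 2 - N ^ 2 := by linarith
      linear_combination t ^ 2 * this
    have h0 : 0 ≤ R * t := by positivity
    have h1 : 0 ≤ R * t + (6 * ρ - N * t) := by nlinarith
    have h2 : R * t + N * t - 6 * ρ ≤ 0 := by linarith
    have h3 := mul_nonpos_of_nonneg_of_nonpos h1 h2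
    rw [← hfac] at h3
    have := nonpos_of_mul_nonpos_right h3 (by positivity)
    linarith
  -- The quadratic inequality is 3Γκt plus a nonnegative term, since Γ ≥ ρ and κt ≤ 1/2. So Γκt ≤ ρ,
  -- which is the claim once Γ is expanded.
  have hmain : 2 * (κ * t) * T ≤ ρ * (1 - κ * t) := by
    have h1 : 0 ≤ t * ((1 - 2 * ρ) - κ * t * (1 - 2 * Γ)) := by
      refine mul_nonneg ht0.le ?_
      have : κ * t * (1 - 2 * Γ) ≤ κ * t * (1 - 2 * ρ) := by gcongr
      nlinarith
    have h2 : M * t ^ 2 + N * t =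
        3 * (Γ * (κ * t)) + 2 * (t * ((1 - 2 * ρ) - κ * t * (1 - 2 * Γ))) := by
      rw [hM, hN]; ring
    have h3 : Γ * (κ * t) = ρ * (κ * t) + 2 * (κ * t) * T := by rw [hΓ]; ring
    linarith
  have hinv : 1 / t ≤ 3 + 2 / ρ + κ * (3 + 2 * (T / ρ)) := by
    have hTρ : 0 ≤ T / ρ := by positivity
    have hρinv : 0 < 1 / ρ := by positivity
    have h2ρ : 2 / ρ = 2 * (1 / ρ) := by ring
    have hκT : 0 ≤ κ * (T / ρ) := by positivity
    -- The summand 16ρN of (N + 8ρ)² - N² contains 48ρΓκ, exactly the positive part of 12ρM.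
    have hRle : R ≤ N + 8 * ρ := by
      refine Real.sqrt_le_iff.2 ⟨by positivity, ?_⟩
      rw [hM, hN]
      nlinarith [mul_pos hρ hκ, mul_pos hρ hρ']
    have hcases : t = 3 / 5 ∨ t = 3 * ρ / (2 * (1 - 2 * ρ)) ∨ t = 1 / (2 * κ) ∨
        t = 6 * ρ / (N + R) := by
      rcases min_choice (min (3 / 5) (3 * ρ / (2 * (1 - 2 * ρ))))
        (min (1 / (2 * κ)) (6 * ρ / (N + R))) with h | h
      · rcases min_choice (3 / 5) (3 * ρ / (2 * (1 - 2 * ρ))) with h' | h'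
        · exact Or.inl (ht.trans (h.trans h'))
        · exact Or.inr (Or.inl (ht.trans (h.trans h')))
      · rcases min_choice (1 / (2 * κ)) (6 * ρ / (N + R)) with h' | h'
        · exact Or.inr (Or.inr (Or.inl (ht.trans (h.trans h'))))
        · exact Or.inr (Or.inr (Or.inr (ht.trans (h.trans h'))))
    have hexp : κ * (3 + 2 * (T / ρ)) = 3 * κ + 2 * (κ * (T / ρ)) := by ring
    rw [hexp, h2ρ]
    rcases hcases with h | h | h | h <;> rw [h]
    · linarith
    · rw [one_div_div]
      have : 2 * (1 - 2 * ρ) / (3 * ρ) = (2 / 3) * (1 / ρ) - 4 / 3 := by field_simp; ring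
      linarith
    · rw [one_div_one_div]
      linarith
    · rw [one_div_div]
      have h1 : (N + R) / (6 * ρ) ≤ (2 * N + 8 * ρ) / (6 * ρ) :=
        div_le_div_of_nonneg_right (by linarith) (by positivity)
      have h2 : (2 * N + 8 * ρ) / (6 * ρ) = κ + 2 * (κ * (T / ρ)) + (2 / 3) * (1 / ρ) := by
        rw [hN, hΓ]; field_simp; ring
      linarith
  have hpos : 0 < betaBar σ κ ρ Θ Θ' := by
    have : 0 < betaBar σ κ ρ Θ Θ' * σ := hbeta ▸ ht0
    exact pos_of_mul_pos_left this hσ.le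
  rw [hbeta]
  exact ⟨hpos, ht1, htρ, hκt, hmain, hinv⟩

/-- What the convergence analysis needs to know about the step size `η`. -/
structure StepSizeBounds (L σ η ρ ν Q : ℝ) : Prop where
  pos : 0 < η
  ησ_le : η * σ ≤ 3 / 5
  ησ_le_ρ : η * σ ≤ 3 * ρ
  ηL_le : η * L ≤ 1 / 2
  noise : 4 * (η * L) * ν ≤ 1 - η * L
  inv_le : 1 / (η * σ) ≤ 3 + 2 / ρ + L / σ * (3 + 32 / Q)

variable {L : ℝ}

lemma svrgBeta_bounds (hL : 0 < L) (hσ : 0 < σ) {b : ℕ} (hb : 0 < b) {p : ℝ} (hp0 : 0 < p)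
    (hp1 : p < 1) :
    StepSizeBounds L σ (svrgBeta L σ b p) (p / 2)
      ((2 - p) / b + (1 - p) / (2 * b) * ((2 - 3 * p + 2 * p ^ 2) / p) / (p / 2))
      (b * p ^ 2) := by
  have hb' : (0 : ℝ) < b := by exact_mod_cast hb
  have hsum : (4 - 6 * p + 3 * p ^ 2) / (b * p) + 2 * (2 - 3 * p + p ^ 2) / (b * p) =
      (8 - 12 * p + 5 * p ^ 2) / (b * p) := by ring
  have hpos : 0 ≤ 8 - 12 * p + 5 * p ^ 2 := by nlinarith [sq_nonneg (5 * p - 6)]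
  obtain ⟨h1, h2, h3, h4, h5, h6⟩ := betaBar_spec (σ := σ) (κ := L / σ) (ρ := p / 2)
    (Θ := (4 - 6 * p + 3 * p ^ 2) / (b * p)) (Θ' := 2 * (2 - 3 * p + p ^ 2) / (b * p)) hσ
    (by positivity) (by positivity) (by linarith)
    (by rw [hsum]; positivity)
  rw [hsum] at h5 h6
  change 0 < svrgBeta L σ b p at h1
  change svrgBeta L σ b p * σ ≤ 3 / 5 at h2
  change svrgBeta L σ b p * σ ≤ 3 * (p / 2) at h3
  change L / σ * (svrgBeta L σ b p * σ) ≤ 1 / 2 at h4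
  change 2 * (L / σ * (svrgBeta L σ b p * σ)) * _ ≤ p / 2 * (1 - L / σ * (svrgBeta L σ b p * σ))
    at h5
  change 1 / (svrgBeta L σ b p * σ) ≤ _ at h6
  set η := svrgBeta L σ b p
  have hηL : L / σ * (η * σ) = η * L := by field_simp
  rw [hηL] at h4 h5
  refine ⟨h1, h2, h3, h4, ?_, h6.trans ?_⟩
  · have hη : 0 < η * L := by positivity
    have e1 : (2 - p) / b + (1 - p) / (2 * b) * ((2 - 3 * p + 2 * p ^ 2) / p) / (p / 2) =
        (2 - 5 * p + 7 * p ^ 2 - 3 * p ^ 3) / (b * p ^ 2) := by field_simp; ring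
    have e2 : (8 - 12 * p + 5 * p ^ 2) / (b * p) =
        (p / 2) * (2 * (8 - 12 * p + 5 * p ^ 2) / (b * p ^ 2)) := by field_simp
    rw [e2] at h5
    have h7 : 2 * (η * L) * (2 * (8 - 12 * p + 5 * p ^ 2) / (b * p ^ 2)) ≤ 1 - η * L := by
      have : p / 2 * (2 * (η * L) * (2 * (8 - 12 * p + 5 * p ^ 2) / (b * p ^ 2))) ≤
          p / 2 * (1 - η * L) := by linarith
      exact le_of_mul_le_mul_left this (by positivity)
    refine le_trans ?_ h7
    rw [e1]
    have h8 : 2 * ((2 - 5 * p + 7 * p ^ 2 - 3 * p ^ 3) / (b * p ^ 2)) ≤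
        2 * (8 - 12 * p + 5 * p ^ 2) / (b * p ^ 2) := by
      rw [← mul_div_assoc]
      gcongr ?_ / _
      have : 0 ≤ (1 - p) * (6 - p - 3 * p ^ 2) := mul_nonneg (by linarith) (by nlinarith)
      nlinarith
    calc 4 * (η * L) * ((2 - 5 * p + 7 * p ^ 2 - 3 * p ^ 3) / (b * p ^ 2)) =
          2 * (η * L) * (2 * ((2 - 5 * p + 7 * p ^ 2 - 3 * p ^ 3) / (b * p ^ 2))) := by ring
      _ ≤ _ := by gcongr
  · have h9 : 2 * ((8 - 12 * p + 5 * p ^ 2) / (b * p) / (p / 2)) ≤ 32 / (b * p ^ 2) := by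
      have : 2 * ((8 - 12 * p + 5 * p ^ 2) / (b * p) / (p / 2)) =
          (4 * (8 - 12 * p + 5 * p ^ 2)) / (b * p ^ 2) := by field_simp; ring
      rw [this]
      gcongr
      nlinarith
    gcongr

lemma sagaBeta_bounds (hL : 0 < L) (hσ : 0 < σ) {n b : ℕ} (hn : 17 ^ 3 ≤ n) (hb : 0 < b)
    (hbn : b < n) :
    StepSizeBounds L σ (sagaBeta L σ n b) ((b : ℝ) / (2 * n))
      (2 / b + 1 / (2 * b) * ((1 - (b : ℝ) / n) * (2 - (b : ℝ) / n) / ((b : ℝ) / n))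
        / ((b : ℝ) / (2 * n)))
      (b * ((b : ℝ) / n) ^ 2) := by
  have hb' : (0 : ℝ) < b := by exact_mod_cast hb
  have hn' : (17 : ℝ) ^ 3 ≤ n := by exact_mod_cast hn
  have hn0 : (0 : ℝ) < n := lt_of_lt_of_le (by norm_num) hn'
  have hbn' : (b : ℝ) < n := by exact_mod_cast hbn
  set p : ℝ := (b : ℝ) / n with hp
  have hp0 : 0 < p := by positivity
  have hp1 : p < 1 := by rw [hp, div_lt_one hn0]; exact hbn'
  have hbp : (b : ℝ) = p * n := by rw [hp]; field_simp
  have hρ : (b : ℝ) / (2 * n) = p / 2 := by rw [hp]; ring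
  have hsum : (2 * ((n : ℝ) - b) * (2 * n + b) + (b : ℝ) ^ 2) / (n * (b : ℝ) ^ 2) +
      2 * ((n : ℝ) - b) * (2 * n + b) / (n * (b : ℝ) ^ 2) =
      (8 - 4 * p - 3 * p ^ 2) / (b * p) := by
    rw [hp]; field_simp; ring
  have hpos : 0 ≤ 8 - 4 * p - 3 * p ^ 2 := by nlinarith
  obtain ⟨h1, h2, h3, h4, h5, h6⟩ := betaBar_spec (σ := σ) (κ := L / σ) (ρ := (b : ℝ) / (2 * n))
    (Θ := (2 * ((n : ℝ) - b) * (2 * n + b) + (b : ℝ) ^ 2) / (n * (b : ℝ) ^ 2))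
    (Θ' := 2 * ((n : ℝ) - b) * (2 * n + b) / (n * (b : ℝ) ^ 2)) hσ
    (by positivity) (by positivity) (by rw [hρ]; linarith)
    (by rw [hsum]; positivity)
  rw [hsum] at h5 h6
  change 0 < sagaBeta L σ n b at h1
  change sagaBeta L σ n b * σ ≤ 3 / 5 at h2
  change sagaBeta L σ n b * σ ≤ 3 * ((b : ℝ) / (2 * n)) at h3
  change L / σ * (sagaBeta L σ n b * σ) ≤ 1 / 2 at h4
  change 2 * (L / σ * (sagaBeta L σ n b * σ)) * _ ≤
    (b : ℝ) / (2 * n) * (1 - L / σ * (sagaBeta L σ n b * σ)) at h5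
  change 1 / (sagaBeta L σ n b * σ) ≤ _ at h6
  set η := sagaBeta L σ n b
  have hηL : L / σ * (η * σ) = η * L := by field_simp
  rw [hηL] at h4 h5
  refine ⟨h1, h2, h3, h4, ?_, h6.trans ?_⟩
  · have hη : 0 < η * L := by positivity
    have e1 : 2 / (b : ℝ) + 1 / (2 * b) * ((1 - p) * (2 - p) / p) / ((b : ℝ) / (2 * n)) =
        (2 - 3 * p + 3 * p ^ 2) / (b * p ^ 2) := by rw [hρ]; field_simp; ring
    rw [e1]
    -- Comparison with Θ + Θ' needs 6 - p - 6p² ≥ 0, which fails near p = 1. There n ≥ 17³ makes b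
    -- so large that the noise coefficient is at most 1/4, and ηL ≤ 1/2 suffices.
    rcases le_or_gt p (9 / 10) with hp9 | hp9
    · have e2 : (8 - 4 * p - 3 * p ^ 2) / (b * p) =
          (p / 2) * (2 * (8 - 4 * p - 3 * p ^ 2) / (b * p ^ 2)) := by field_simp
      rw [e2, hρ] at h5
      have h7 : 2 * (η * L) * (2 * (8 - 4 * p - 3 * p ^ 2) / (b * p ^ 2)) ≤ 1 - η * L := by
        have : p / 2 * (2 * (η * L) * (2 * (8 - 4 * p - 3 * p ^ 2) / (b * p ^ 2))) ≤
            p / 2 * (1 - η * L) := by linarith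
        exact le_of_mul_le_mul_left this (by positivity)
      refine le_trans ?_ h7
      have h8 : 2 * ((2 - 3 * p + 3 * p ^ 2) / (b * p ^ 2)) ≤
          2 * (8 - 4 * p - 3 * p ^ 2) / (b * p ^ 2) := by
        rw [← mul_div_assoc]
        gcongr ?_ / _
        nlinarith
      calc 4 * (η * L) * ((2 - 3 * p + 3 * p ^ 2) / (b * p ^ 2)) =
            2 * (η * L) * (2 * ((2 - 3 * p + 3 * p ^ 2) / (b * p ^ 2))) := by ring
        _ ≤ _ := by gcongr
    · have hbig : 1000 ≤ (b : ℝ) := by rw [hbp]; nlinarith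
      have h8 : (2 - 3 * p + 3 * p ^ 2) / (b * p ^ 2) ≤ 1 / 4 := by
        rw [div_le_iff₀ (by positivity)]
        nlinarith
      have h9 : 4 * (η * L) * ((2 - 3 * p + 3 * p ^ 2) / (b * p ^ 2)) ≤
          4 * (η * L) * (1 / 4) := by gcongr
      linarith
  · have h9 : 2 * ((8 - 4 * p - 3 * p ^ 2) / (b * p) / ((b : ℝ) / (2 * n))) ≤
        32 / (b * p ^ 2) := by
      have : 2 * ((8 - 4 * p - 3 * p ^ 2) / (b * p) / ((b : ℝ) / (2 * n))) =
          (4 * (8 - 4 * p - 3 * p ^ 2)) / (b * p ^ 2) := by rw [hρ]; field_simp; ring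
      rw [this]
      gcongr
      nlinarith
    gcongr

end StepSize

/-! ### From linear convergence to the oracle complexity -/

section Complexity

/-- The number of iterations after which a linearly convergent sequence stays below `ε²`. -/
lemma exists_iteration_count {t ε D : ℝ} (ht0 : 0 < t) (ht1 : t ≤ 1) (hε : 0 < ε)
    (hε2 : ε ≤ 1 / 2) (hD : 0 ≤ D) :
    ∃ K : ℕ, (K : ℝ) ≤ 122 * (1 / t) * (Real.log (1 / ε) + Real.log (max 1 D)) ∧
      ∀ k, K ≤ k → 8 * (1 - t / 24) ^ k * D ^ 2 ≤ ε ^ 2 := by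
  set m := max 1 D with hm
  have hm1 : 1 ≤ m := le_max_left _ _
  have hm0 : 0 < m := by linarith
  set Λ := Real.log (1 / ε) + Real.log m with hΛ
  have hlog2 : Real.log 2 ≤ Real.log (1 / ε) := by
    apply Real.log_le_log (by norm_num)
    rw [le_div_iff₀ hε]; linarith
  have hlogm : 0 ≤ Real.log m := Real.log_nonneg hm1
  have hl2 := Real.log_two_gt_d9
  have hΛ2 : 1 / 2 ≤ Λ := by linarith
  have hinv : 1 ≤ 1 / t := by rw [le_div_iff₀ ht0]; linarith
  set z := Real.log (8 * m ^ 2 / ε ^ 2) with hz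
  have hz5 : z ≤ 5 * Λ := by
    have h8 : Real.log 8 = 3 * Real.log 2 := by
      rw [show (8 : ℝ) = 2 ^ 3 by norm_num, Real.log_pow]; norm_num
    have : z = 3 * Real.log 2 + 2 * Real.log m + 2 * Real.log (1 / ε) := by
      rw [hz, Real.log_div (by positivity) (by positivity), Real.log_mul (by norm_num)
        (by positivity), Real.log_pow, Real.log_pow, h8, one_div, Real.log_inv]
      push_cast
      ring
    linarith
  -- Since Λ ≥ log 2, z = 3 log 2 + 2Λ ≤ 5Λ. Rounding up costs at most 1 ≤ 2Λ/t, whence 122 = 24 · 5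
  -- + 2.
  refine ⟨⌈24 * (1 / t) * (5 * Λ)⌉₊, ?_, fun k hk => ?_⟩
  · have h1 := (Nat.ceil_lt_add_one (show 0 ≤ 24 * (1 / t) * (5 * Λ) by positivity)).le
    have h2 : (1 / 2 : ℝ) ≤ 1 / t * Λ := by nlinarith
    linarith
  · have hk' : 24 * (1 / t) * (5 * Λ) ≤ k := (Nat.le_ceil _).trans (by exact_mod_cast hk)
    have hkz : z ≤ t / 24 * k := by
      calc z ≤ 5 * Λ := hz5
        _ = t / 24 * (24 * (1 / t) * (5 * Λ)) := by field_simp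
        _ ≤ t / 24 * k := by gcongr
    have hpow : (1 - t / 24) ^ k ≤ ε ^ 2 / (8 * m ^ 2) := by
      calc (1 - t / 24) ^ k ≤ (Real.exp (-(t / 24))) ^ k := by
            apply pow_le_pow_left₀ (by linarith)
            linarith [Real.add_one_le_exp (-(t / 24))]
        _ = Real.exp (-(t / 24 * k)) := by rw [← Real.exp_nat_mul]; ring_nf
        _ ≤ Real.exp (-z) := by gcongr
        _ = ε ^ 2 / (8 * m ^ 2) := by
            rw [Real.exp_neg, hz, Real.exp_log (by positivity), inv_div]
    have hDm : D ^ 2 ≤ m ^ 2 := by gcongr; exact le_max_right _ _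
    calc 8 * (1 - t / 24) ^ k * D ^ 2 ≤ 8 * (ε ^ 2 / (8 * m ^ 2)) * m ^ 2 := by gcongr
      _ = ε ^ 2 := by field_simp

lemma reachesWithin_of_decay {Ω E : Type*} [MeasurableSpace Ω] {μ : Measure Ω}
    [NormedAddCommGroup E] {x : ℕ → Ω → E} {T : ℕ → Ω → ℕ} {xs : E} {t ε D κ A Q : ℝ} {n : ℕ}
    (hn : 0 < n) (ht0 : 0 < t) (ht1 : t ≤ 1) (hε : 0 < ε) (hε2 : ε ≤ 1 / 2) (hD : 0 ≤ D)
    (hA : 0 ≤ A) (hQ : 0 ≤ Q)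
    (hx : ∀ k, Integrable (fun ω => ‖x k ω - xs‖ ^ 2) μ)
    (hdecay : ∀ k, ∫ ω, ‖x k ω - xs‖ ^ 2 ∂μ ≤ 8 * (1 - t / 24) ^ k * D ^ 2)
    (hT : ∀ k, Integrable (fun ω => (T k ω : ℝ)) μ)
    (hcost : ∀ k : ℕ, ∫ ω, (T k ω : ℝ) ∂μ ≤ n + k * (A * (n : ℝ) ^ (2 / 3 : ℝ)))
    (hinv : 1 / t ≤ Q * ((n : ℝ) ^ (1 / 3 : ℝ) + κ)) :
    ReachesWithin μ x T xs ε ((1 + 244 * A * Q) * (n + max (n : ℝ) ((n : ℝ) ^ (2 / 3 : ℝ) * κ) *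
      (Real.log (1 / ε) + Real.log (max 1 D)))) := by
  obtain ⟨K, hK, hKε⟩ := exists_iteration_count ht0 ht1 hε hε2 hD
  refine ⟨K, fun k hk => ⟨hx k, (hdecay k).trans (hKε k hk)⟩, hT K, (hcost K).trans ?_⟩
  have hn' : (0 : ℝ) < n := by exact_mod_cast hn
  set Λ := Real.log (1 / ε) + Real.log (max 1 D) with hΛ
  have hΛ0 : 0 ≤ Λ := add_nonneg
    (Real.log_nonneg (by rw [le_div_iff₀ hε]; linarith)) (Real.log_nonneg (le_max_left _ _))
  set c := (n : ℝ) ^ (2 / 3 : ℝ) with hc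
  have hc0 : 0 < c := by positivity
  have hmul : (n : ℝ) ^ (1 / 3 : ℝ) * c = n := by
    rw [hc, ← Real.rpow_add hn']; norm_num
  set m := max (n : ℝ) (c * κ) with hm
  have hm0 : 0 < m := lt_of_lt_of_le hn' (le_max_left _ _)
  have hsum : ((n : ℝ) ^ (1 / 3 : ℝ) + κ) * c ≤ 2 * m := by
    have h1 : (n : ℝ) ≤ m := le_max_left _ _
    have h2 : c * κ ≤ m := le_max_right _ _
    rw [add_mul, hmul]; linarith
  have h1 : (K : ℝ) * (A * c) ≤ 244 * A * Q * (m * Λ) := by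
    calc (K : ℝ) * (A * c) ≤ (122 * (1 / t) * Λ) * (A * c) := by gcongr
      _ ≤ (122 * (Q * ((n : ℝ) ^ (1 / 3 : ℝ) + κ)) * Λ) * (A * c) := by gcongr
      _ = 122 * A * Q * Λ * (((n : ℝ) ^ (1 / 3 : ℝ) + κ) * c) := by ring
      _ ≤ 122 * A * Q * Λ * (2 * m) := by gcongr
      _ = _ := by ring
  have h2 : 0 ≤ m * Λ := by positivity
  have h3 : 0 ≤ 244 * A * Q * n := by positivity
  calc (n : ℝ) + K * (A * c) ≤ n + 244 * A * Q * (m * Λ) := by gcongr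
    _ ≤ (1 + 244 * A * Q) * (n + m * Λ) := by nlinarith

lemma inv_step_le {L σ η ρ ν c₁ p Q : ℝ} {n : ℕ} (hn : 0 < n) (hL : 0 < L) (hσ : 0 < σ)
    (hc₁ : 0 < c₁) (h : StepSizeBounds L σ η ρ ν Q) (hρ : ρ = p / 2)
    (hp : c₁ / (n : ℝ) ^ (1 / 3 : ℝ) ≤ p) (hQ : c₁ ^ 3 ≤ Q) :
    1 / (η * σ) ≤ (3 + 4 / c₁ + 32 / c₁ ^ 3) * ((n : ℝ) ^ (1 / 3 : ℝ) + L / σ) := by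
  have hn1 : (1 : ℝ) ≤ n := by exact_mod_cast hn
  set a := (n : ℝ) ^ (1 / 3 : ℝ) with ha
  have ha1 : 1 ≤ a := Real.one_le_rpow hn1 (by norm_num)
  have ha0 : 0 < a := by linarith
  have hp0 : 0 < p := lt_of_lt_of_le (by positivity) hp
  have hκ : 0 < L / σ := by positivity
  have h1 : 2 / ρ ≤ 4 / c₁ * a := by
    rw [hρ]
    calc 2 / (p / 2) = 4 / p := by field_simp; norm_num
      _ ≤ 4 / (c₁ / a) := by gcongr
      _ = _ := by field_simp
  have h2 : 32 / Q ≤ 32 / c₁ ^ 3 := by gcongr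
  have h3 : L / σ * (3 + 32 / Q) ≤ L / σ * (3 + 32 / c₁ ^ 3) := by gcongr
  have h4 : 0 < 4 / c₁ := by positivity
  have h5 : 0 < 32 / c₁ ^ 3 := by positivity
  refine h.inv_le.trans ?_
  have h6 : 0 < 4 / c₁ * (L / σ) := by positivity
  have h7 : 0 < 32 / c₁ ^ 3 * a := by positivity
  nlinarith

/-- The balance behind the exponents 2/3 and -1/3: b p² stays bounded below, so the factor of κ in
1/(ησ) does not grow with n. -/
lemma cube_le_mul_sq {c₁ p : ℝ} {n b : ℕ} (hn : 0 < n) (hc₁ : 0 < c₁)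
    (hb : c₁ * (n : ℝ) ^ (2 / 3 : ℝ) ≤ b) (hp : c₁ / (n : ℝ) ^ (1 / 3 : ℝ) ≤ p) :
    c₁ ^ 3 ≤ b * p ^ 2 := by
  have hn' : (0 : ℝ) < n := by exact_mod_cast hn
  have ha : (n : ℝ) ^ (2 / 3 : ℝ) = ((n : ℝ) ^ (1 / 3 : ℝ)) ^ 2 := by
    rw [← Real.rpow_natCast, ← Real.rpow_mul hn'.le]; norm_num
  rw [ha] at hb
  set a := (n : ℝ) ^ (1 / 3 : ℝ)
  have ha0 : 0 < a := by positivity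
  calc c₁ ^ 3 = (c₁ * a ^ 2) * (c₁ / a) ^ 2 := by field_simp
    _ ≤ b * p ^ 2 := by gcongr

end Complexity

/-! ### Linear convergence and expected cost of the two variants -/

section Convergence

variable {n b : ℕ} {E : Type} [NormedAddCommGroup E] [InnerProductSpace ℝ E]
  {G : Fin n → E → E} {L σ η : ℝ} {xs : E} {Ω : Type*} [MeasurableSpace Ω] {μ : Measure Ω}
  [IsProbabilityMeasure μ] {B : ℕ → Ω → Finset (Fin n)} {p : ℝ} {coin : ℕ → Ω → Bool}

lemma IsSVRGSampling.integrable_cur (h : IsSVRGSampling μ b p B coin) (θ γ η : ℝ) (x₀ xs : E)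
    (k : ℕ) : Integrable (fun ω => ‖((svrgRun θ γ η (fun j => B j ω) (fun j => coin j ω)
      x₀ k).eval G).cur - xs‖ ^ 2) μ := by
  set s : ℕ → Ω → SVRGState E := fun k ω =>
    (svrgRun θ γ η (fun j => B j ω) (fun j => coin j ω) x₀ k).eval G with hs
  have hm : ∀ k, Measurable fun ω => (B k ω, coin k ω) := fun k =>
    (h.batches.measurable k).prodMk (h.measurable_coin k)
  have h0 : ∀ ω, s 0 ω = ⟨x₀, x₀, x₀, meanOp G x₀⟩ := fun _ => eval_svrgRun_zero G _ _ η _ _ x₀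
  have hsucc : ∀ k ω, s (k + 1) ω = svrgNext G θ γ η (B k ω) (coin k ω) (s k ω) :=
    fun k _ => eval_svrgRun_succ G _ _ η _ _ x₀ k
  exact integrable_recursion
    (step := fun (w : Finset (Fin n) × Bool) s => svrgNext G θ γ η w.1 w.2 s)
    hm h0 hsucc (fun s => ‖s.cur - xs‖ ^ 2) k

/-- Linear convergence of the SVRG variant. -/
lemma IsSVRGSampling.integral_cur_le (h : IsSVRGSampling μ b p B coin)
    (A : StepAssumptions G L σ η xs) (hb0 : 0 < b) (hb : b ≤ n) (hp0 : 0 < p) (hp1 : p < 1)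
    (hσρ : η * σ ≤ 3 * (p / 2))
    (hν : 4 * (η * L) * ((2 - p) / b
      + (1 - p) / (2 * b) * ((2 - 3 * p + 2 * p ^ 2) / p) / (p / 2)) ≤ 1 - η * L)
    (x₀ : E) (k : ℕ) :
    ∫ ω, ‖((svrgRun (1 / 3) (1 / 2) η (fun j => B j ω) (fun j => coin j ω)
      x₀ k).eval G).cur - xs‖ ^ 2 ∂μ ≤ 8 * (1 - η * σ / 24) ^ k * ‖x₀ - xs‖ ^ 2 := by
  set s : ℕ → Ω → SVRGState E := fun k ω =>
    (svrgRun (1 / 3) (1 / 2) η (fun j => B j ω) (fun j => coin j ω) x₀ k).eval G with hs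
  have hm : ∀ k, Measurable fun ω => (B k ω, coin k ω) := fun k =>
    (h.batches.measurable k).prodMk (h.measurable_coin k)
  have h0 : ∀ ω, s 0 ω = ⟨x₀, x₀, x₀, meanOp G x₀⟩ := fun _ => eval_svrgRun_zero G _ _ η _ _ x₀
  have hsucc : ∀ k ω, s (k + 1) ω = svrgNext G (1 / 3) (1 / 2) η (B k ω) (coin k ω) (s k ω) :=
    fun k _ => eval_svrgRun_succ G _ _ η _ _ x₀ k
  have hdecay := integral_recursion_le (μ := μ)
    (step := fun (w : Finset (Fin n) × Bool) s => svrgNext G (1 / 3) (1 / 2) η w.1 w.2 s)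
    (ξ := fun k ω => (B k ω, coin k ω)) hm h.indep_pairs h0 hsucc
    (q := 1 - η * σ / 24) (by linarith [A.ησ_le]) (svrgLyap G η b p xs)
    (fun k x => by
      simp only [h.real_pair hb]
      exact A.sum_svrgLyap_le hb0 hb hp0 hp1 hσρ hν x) k
  -- The snapshot starts at x^0 = x^{-1}, so the gap vanishes initially. The factor 4 here and the
  -- factor 2 in `hlow` produce the 8 of the decay bound.
  have hinit : svrgLyap G η b p xs ⟨x₀, x₀, x₀, meanOp G x₀⟩ ≤ 4 * ‖x₀ - xs‖ ^ 2 := by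
    have hgap : svrgGap G ⟨x₀, x₀, x₀, meanOp G x₀⟩ = 0 := by
      simp [svrgGap, meanSqDiff, meanSq]
    unfold svrgLyap
    rw [hgap, mul_zero, add_zero]
    exact A.potential_init_le x₀
  have hlow : ∀ x : SVRGState E, ‖x.cur - xs‖ ^ 2 ≤ 2 * svrgLyap G η b p xs x := fun x => by
    have h1 := norm_sq_le_potential (G := G) η xs x.cur x.prev
    have h2 : 0 ≤ (22 / 7) * ((1 - p) / (2 * b) / (p / 2)) * η ^ 2 * svrgGap G x := by
      have : 0 ≤ 1 - p := by linarith
      have : 0 ≤ svrgGap G x := meanSq_nonneg _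
      positivity
    unfold svrgLyap
    linarith
  calc ∫ ω, ‖(s k ω).cur - xs‖ ^ 2 ∂μ ≤ ∫ ω, 2 * svrgLyap G η b p xs (s k ω) ∂μ :=
        integral_mono (h.integrable_cur _ _ η x₀ xs k)
          ((integrable_recursion
            (step := fun (w : Finset (Fin n) × Bool) s => svrgNext G (1 / 3) (1 / 2) η w.1 w.2 s)
            hm h0 hsucc (svrgLyap G η b p xs) k).const_mul 2)
          fun ω => hlow (s k ω)
    _ = 2 * ∫ ω, svrgLyap G η b p xs (s k ω) ∂μ := integral_const_mul _ _
    _ ≤ 2 * ((1 - η * σ / 24) ^ k * (4 * ‖x₀ - xs‖ ^ 2)) := by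
        refine mul_le_mul_of_nonneg_left (hdecay.trans ?_) (by norm_num)
        exact mul_le_mul_of_nonneg_left hinit (pow_nonneg (by linarith [A.ησ_le]) k)
    _ = _ := by ring

/-- The expected cost of the first `k` iterations of the SVRG variant. -/
lemma IsSVRGSampling.integral_calls (h : IsSVRGSampling μ b p B coin) (hb : b ≤ n)
    (θ γ η : ℝ) (x₀ : E) (k : ℕ) :
    Integrable (fun ω => ((svrgRun θ γ η (fun j => B j ω) (fun j => coin j ω)
      x₀ k).calls G : ℝ)) μ ∧
    ∫ ω, ((svrgRun θ γ η (fun j => B j ω) (fun j => coin j ω) x₀ k).calls G : ℝ) ∂μ =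
      n + k * (p * n + 3 * b) := by
  simp only [calls_svrgRun, Nat.cast_add, Nat.cast_sum, Nat.cast_mul, Nat.cast_ite,
    Nat.cast_ofNat, CharP.cast_eq_zero]
  have hc : ∀ j, Integrable (fun ω => if coin j ω = true then (n : ℝ) else 0) μ := fun j =>
    integrable_comp_of_finite (h.measurable_coin j) fun c => if c = true then (n : ℝ) else 0
  have hB : ∀ j, Integrable (fun ω => (3 : ℝ) * ((B j ω).card : ℝ)) μ := fun j =>
    integrable_comp_of_finite (h.batches.measurable j) fun S => (3 : ℝ) * (S.card : ℝ)
  have hcB : ∀ j, Integrable (fun ω => (if coin j ω = true then (n : ℝ) else 0)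
      + 3 * ((B j ω).card : ℝ)) μ := fun j => (hc j).add (hB j)
  have hsum : Integrable (fun ω => ∑ j ∈ Finset.range k,
      ((if coin j ω = true then (n : ℝ) else 0) + 3 * ((B j ω).card : ℝ))) μ :=
    integrable_finsetSum _ fun j _ => hcB j
  refine ⟨(integrable_const _).add hsum, ?_⟩
  rw [integral_add (integrable_const _) hsum, integral_finsetSum _ fun j _ => hcB j]
  have hone : ∀ j, ∫ ω, ((if coin j ω = true then (n : ℝ) else 0) + 3 * ((B j ω).card : ℝ)) ∂μ =
      p * n + 3 * b := fun j => by
    have hset : MeasurableSet {ω | coin j ω = true} :=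
      h.measurable_coin j (measurableSet_singleton true)
    rw [integral_add (hc j) (hB j)]
    congr 1
    · have : (fun ω => if coin j ω = true then (n : ℝ) else 0) =
          Set.indicator {ω | coin j ω = true} fun _ => (n : ℝ) := by
        funext ω; simp [Set.indicator_apply]
      rw [this, integral_indicator_const _ hset, h.law_coin j, smul_eq_mul]
    · rw [integral_congr_ae (g := fun _ => (3 : ℝ) * b)]
      · simp
      · filter_upwards [h.batches.ae_card hb j] with ω hω
        rw [hω]
  simp [hone]
  ring

lemma IsMinibatchSampling.integrable_cur (h : IsMinibatchSampling μ b B) (θ γ η : ℝ) (x₀ xs : E)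
    (k : ℕ) : Integrable (fun ω => ‖((sagaRun θ γ η (fun j => B j ω) x₀ k).eval G).cur
      - xs‖ ^ 2) μ :=
  integrable_recursion (step := fun w s => sagaNext G θ γ η w s) (ξ := B)
    (s := fun k ω => (sagaRun θ γ η (fun j => B j ω) x₀ k).eval G) h.measurable
    (fun _ => eval_sagaRun_zero G θ γ η _ x₀) (fun k _ => eval_sagaRun_succ G θ γ η _ x₀ k)
    (fun s => ‖s.cur - xs‖ ^ 2) k

/-- Linear convergence of the SAGA variant. -/
lemma IsMinibatchSampling.integral_cur_le (h : IsMinibatchSampling μ b B)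
    (A : StepAssumptions G L σ η xs) (hb0 : 0 < b) (hb : b < n)
    (hσρ : η * σ ≤ 3 * ((b : ℝ) / (2 * n)))
    (hν : 4 * (η * L) * (2 / b
      + 1 / (2 * b) * ((1 - (b : ℝ) / n) * (2 - (b : ℝ) / n) / ((b : ℝ) / n)) / ((b : ℝ) / (2 * n)))
        ≤ 1 - η * L)
    (x₀ : E) (k : ℕ) :
    ∫ ω, ‖((sagaRun (1 / 3) (1 / 2) η (fun j => B j ω) x₀ k).eval G).cur - xs‖ ^ 2 ∂μ ≤
      8 * (1 - η * σ / 24) ^ k * ‖x₀ - xs‖ ^ 2 := by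
  set s : ℕ → Ω → SAGAState n E := fun k ω =>
    (sagaRun (1 / 3) (1 / 2) η (fun j => B j ω) x₀ k).eval G with hs
  have h0 : ∀ ω, s 0 ω = ⟨x₀, x₀, fun i => G i x₀⟩ := fun _ => eval_sagaRun_zero G _ _ η _ x₀
  have hsucc : ∀ k ω, s (k + 1) ω = sagaNext G (1 / 3) (1 / 2) η (B k ω) (s k ω) :=
    fun k _ => eval_sagaRun_succ G _ _ η _ x₀ k
  have hdecay := integral_recursion_le (μ := μ)
    (step := fun (w : Finset (Fin n)) s => sagaNext G (1 / 3) (1 / 2) η w s)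
    (ξ := B) h.measurable h.indep h0 hsucc
    (q := 1 - η * σ / 24) (by linarith [A.ησ_le]) (sagaLyap G η b xs)
    (fun k x => by
      simp only [h.real_eq hb.le]
      exact A.sum_sagaLyap_le hb0 hb hσρ hν x) k
  have hinit : sagaLyap G η b xs ⟨x₀, x₀, fun i => G i x₀⟩ ≤ 4 * ‖x₀ - xs‖ ^ 2 := by
    have hgap : sagaGap G ⟨x₀, x₀, fun i => G i x₀⟩ = 0 := by
      simp [sagaGap, meanSq]
    unfold sagaLyap
    rw [hgap, mul_zero, add_zero]
    exact A.potential_init_le x₀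
  have hlow : ∀ x : SAGAState n E, ‖x.cur - xs‖ ^ 2 ≤ 2 * sagaLyap G η b xs x := fun x => by
    have h1 := norm_sq_le_potential (G := G) η xs x.cur x.prev
    have h2 : 0 ≤ (22 / 7) * (1 / (2 * b) / ((b : ℝ) / (2 * n))) * η ^ 2 * sagaGap G x := by
      have : 0 ≤ sagaGap G x := meanSq_nonneg _
      positivity
    unfold sagaLyap
    linarith
  calc ∫ ω, ‖(s k ω).cur - xs‖ ^ 2 ∂μ ≤ ∫ ω, 2 * sagaLyap G η b xs (s k ω) ∂μ :=
        integral_mono (h.integrable_cur _ _ η x₀ xs k)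
          ((integrable_recursion h.measurable h0 hsucc (sagaLyap G η b xs) k).const_mul 2)
          fun ω => hlow (s k ω)
    _ = 2 * ∫ ω, sagaLyap G η b xs (s k ω) ∂μ := integral_const_mul _ _
    _ ≤ 2 * ((1 - η * σ / 24) ^ k * (4 * ‖x₀ - xs‖ ^ 2)) := by
        refine mul_le_mul_of_nonneg_left (hdecay.trans ?_) (by norm_num)
        exact mul_le_mul_of_nonneg_left hinit (pow_nonneg (by linarith [A.ησ_le]) k)
    _ = _ := by ring

/-- The expected cost of the first `k` iterations of the SAGA variant. -/
lemma IsMinibatchSampling.integral_calls (h : IsMinibatchSampling μ b B) (hb : b ≤ n)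
    (θ γ η : ℝ) (x₀ : E) (k : ℕ) :
    Integrable (fun ω => ((sagaRun θ γ η (fun j => B j ω) x₀ k).calls G : ℝ)) μ ∧
    ∫ ω, ((sagaRun θ γ η (fun j => B j ω) x₀ k).calls G : ℝ) ∂μ = n + k * (2 * b) := by
  simp only [calls_sagaRun, Nat.cast_add, Nat.cast_sum, Nat.cast_mul, Nat.cast_ofNat]
  have hB : ∀ j, Integrable (fun ω => (2 : ℝ) * ((B j ω).card : ℝ)) μ := fun j =>
    integrable_comp_of_finite (h.measurable j) fun S => (2 : ℝ) * (S.card : ℝ)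
  have hsum : Integrable (fun ω => ∑ j ∈ Finset.range k, (2 : ℝ) * ((B j ω).card : ℝ)) μ :=
    integrable_finsetSum _ fun j _ => hB j
  refine ⟨(integrable_const _).add hsum, ?_⟩
  rw [integral_add (integrable_const _) hsum, integral_finsetSum _ fun j _ => hB j]
  have hone : ∀ j, ∫ ω, (2 : ℝ) * ((B j ω).card : ℝ) ∂μ = 2 * b := fun j => by
    rw [integral_congr_ae (g := fun _ => (2 : ℝ) * b)]
    · simp
    · filter_upwards [h.ae_card hb j] with ω hω
      rw [hω]
  simp [hone]

end Convergence

theorem mainTheorem8 (c₁ c₂ : ℝ) (hc₁ : 0 < c₁) (hc₂ : c₁ ≤ c₂) :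
    ∃ C : ℝ, 0 < C ∧
      ∀ (n d : ℕ) (_ : 17 ^ 3 ≤ n)
        (G : Fin n → EuclideanSpace ℝ (Fin d) → EuclideanSpace ℝ (Fin d))
        (L σ : ℝ) (_ : 0 < L) (_ : 0 < σ) (_ : AverageCocoercive G L)
        (xs : EuclideanSpace ℝ (Fin d)) (_ : StronglyQuasiMonotoneAt (meanOp G) σ xs)
        (x₀ : EuclideanSpace ℝ (Fin d))
        (b : ℕ) (_ : c₁ * (n : ℝ) ^ (2 / 3 : ℝ) ≤ b) (_ : (b : ℝ) ≤ c₂ * (n : ℝ) ^ (2 / 3 : ℝ))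
        (ε : ℝ) (_ : 0 < ε) (_ : ε ≤ 1 / 2)
        (Ω : Type*) [MeasurableSpace Ω] (μ : Measure Ω) [IsProbabilityMeasure μ]
        (B : ℕ → Ω → Finset (Fin n)),
        -- the SVRG variant
        (∀ (_ : b ≤ n) (p : ℝ) (_ : 0 < p) (_ : p < 1)
          (_ : c₁ / (n : ℝ) ^ (1 / 3 : ℝ) ≤ p) (_ : p ≤ c₂ / (n : ℝ) ^ (1 / 3 : ℝ))
          (coin : ℕ → Ω → Bool) (_ : IsSVRGSampling μ b p B coin),
          ReachesWithin μ
            (fun k ω => ((svrgRun (1 / 3) (1 / 2) (svrgBeta L σ b p)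
              (fun j => B j ω) (fun j => coin j ω) x₀ k).eval G).cur)
            (fun k ω => (svrgRun (1 / 3) (1 / 2) (svrgBeta L σ b p)
              (fun j => B j ω) (fun j => coin j ω) x₀ k).calls G)
            xs ε
            (C * (n + max (n : ℝ) ((n : ℝ) ^ (2 / 3 : ℝ) * (L / σ)) *
              (Real.log (1 / ε) + Real.log (max 1 ‖x₀ - xs‖))))) ∧
        -- the SAGA variant
        (∀ (_ : b < n) (_ : IsMinibatchSampling μ b B),
          ReachesWithin μ
            (fun k ω => ((sagaRun (1 / 3) (1 / 2) (sagaBeta L σ n b)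
              (fun j => B j ω) x₀ k).eval G).cur)
            (fun k ω => (sagaRun (1 / 3) (1 / 2) (sagaBeta L σ n b)
              (fun j => B j ω) x₀ k).calls G)
            xs ε
            (C * (n + max (n : ℝ) ((n : ℝ) ^ (2 / 3 : ℝ) * (L / σ)) *
              (Real.log (1 / ε) + Real.log (max 1 ‖x₀ - xs‖))))) := by
  have hc₂0 : 0 < c₂ := hc₁.trans_le hc₂
  -- Here 4c₂n^{2/3} bounds the expected cost per iteration, pn + 3b or 2b; the last factor is the
  -- constant of `inv_step_le`, and 244 = 2 · 122 since a sum is replaced by twice a maximum.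
  refine ⟨1 + 244 * (4 * c₂) * (3 + 4 / c₁ + 32 / c₁ ^ 3), by positivity, ?_⟩
  intro n d hn G L σ hL hσ hcoc xs hquasi x₀ b hb1 hb2 ε hε hε2 Ω _ μ _ B
  have hn0 : 0 < n := lt_of_lt_of_le (by norm_num) hn
  have hnR : (0 : ℝ) < n := by exact_mod_cast hn0
  have hb0 : 0 < b := by
    have : (0 : ℝ) < b := lt_of_lt_of_le (by positivity) hb1
    exact_mod_cast this
  have hfrac : (n : ℝ) ^ (2 / 3 : ℝ) * (n : ℝ) ^ (1 / 3 : ℝ) = n := by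
    rw [← Real.rpow_add hnR]; norm_num
  have hdiv : ∀ c : ℝ, c / (n : ℝ) ^ (1 / 3 : ℝ) * n = c * (n : ℝ) ^ (2 / 3 : ℝ) := fun c => by
    have h3 : 0 < (n : ℝ) ^ (1 / 3 : ℝ) := by positivity
    rw [div_mul_eq_mul_div, div_eq_iff h3.ne', mul_assoc, hfrac]
  refine ⟨fun hbn p hp0 hp1 hpl hpu coin h => ?_, fun hbn h => ?_⟩
  · have hη := svrgBeta_bounds hL hσ hb0 hp0 hp1
    have A : StepAssumptions G L σ (svrgBeta L σ b p) xs :=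
      ⟨hn0, hL, hσ, hcoc, hquasi, hη.pos, hη.ηL_le, hη.ησ_le⟩
    refine reachesWithin_of_decay hn0 (mul_pos hη.pos hσ) (hη.ησ_le.trans (by norm_num)) hε hε2
      (norm_nonneg _) (by positivity) (by positivity) (h.integrable_cur _ _ _ x₀ xs)
      (h.integral_cur_le A hb0 hbn hp0 hp1 hη.ησ_le_ρ hη.noise x₀)
      (fun k => (h.integral_calls hbn _ _ _ x₀ k).1) (fun k => ?_)
      (inv_step_le hn0 hL hσ hc₁ hη rfl hpl (cube_le_mul_sq hn0 hc₁ hb1 hpl))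
    rw [(h.integral_calls hbn _ _ _ x₀ k).2]
    gcongr
    have : p * n ≤ c₂ * (n : ℝ) ^ (2 / 3 : ℝ) := by
      rw [← hdiv]
      gcongr
    linarith
  · have hη := sagaBeta_bounds hL hσ hn hb0 hbn
    have A : StepAssumptions G L σ (sagaBeta L σ n b) xs :=
      ⟨hn0, hL, hσ, hcoc, hquasi, hη.pos, hη.ηL_le, hη.ησ_le⟩
    have hpl : c₁ / (n : ℝ) ^ (1 / 3 : ℝ) ≤ (b : ℝ) / n := by
      rw [le_div_iff₀ hnR, hdiv]
      exact hb1
    refine reachesWithin_of_decay hn0 (mul_pos hη.pos hσ) (hη.ησ_le.trans (by norm_num)) hε hε2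
      (norm_nonneg _) (by positivity) (by positivity) (h.integrable_cur _ _ _ x₀ xs)
      (h.integral_cur_le A hb0 hbn hη.ησ_le_ρ hη.noise x₀)
      (fun k => (h.integral_calls hbn.le _ _ _ x₀ k).1) (fun k => ?_)
      (inv_step_le hn0 hL hσ hc₁ hη (by ring) hpl (cube_le_mul_sq hn0 hc₁ hb1 hpl))
    rw [(h.integral_calls hbn.le _ _ _ x₀ k).2]
    have : 0 < c₂ * (n : ℝ) ^ (2 / 3 : ℝ) := by positivity
    have hcost : 2 * (b : ℝ) ≤ 4 * c₂ * (n : ℝ) ^ (2 / 3 : ℝ) := by linarith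
    have := mul_le_mul_of_nonneg_left hcost (Nat.cast_nonneg (α := ℝ) k)
    linarith
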